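/- **Model.** Fix rates $\mu_{i,j}>0$, $\theta_i>0$ ($i,j=1,2$) and ratio parameters $r_{1,2}\ge r_{2,1}>0$ with $r:=r_{1,2}=a/b$ for positive integers $a,b$. For each $n\ge 1$ consider a two-class, two-pool Markovian queueing system with Poisson arrival rates $\lambda^n_i>0$, $m^n_j$ servers in pool $j$, service rate $\mu_{i,j}$ of class $i$ in pool $j$, abandonment rate $\theta_i$ of each waiting class-$i$ customer, and thresholds $k^n_{1,2},k^n_{2,1}>0$. Its state is $X^n_6=(Q_1,Q_2,Z_{1,1},Z_{1,2},Z_{2,1},Z_{2,2})$ ($Q_i$: queue lengths; $Z_{i,j}$: class-$i$ customers in service in pool $j$), and $$D^n_{1,2}=Q_1-k^n_{1,2}-r_{1,2}Q_2,\qquad D^n_{2,1}=r_{2,1}Q_2-k^n_{2,1}-Q_1 .$$ A class-$i$ arrival enters service in pool $i$ if a server there is idle, and otherwise joins queue $i$. A pool-2 server completing a service takes a class-1 customer if $D^n_{1,2}>0$, $Z_{2,1}=0$ and $Q_1>0$; otherwise it takes a class-2 customer if $Q_2>0$, and else idles. Pool 1 follows the same rule with the indices 1 and 2 interchanged. Conditions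 are evaluated just before the completion. This makes $X^n_6$ a CTMC on the set of states in which $Z_{1,j}+Z_{2,j}\le m^n_j$, with equality if $Q_j>0$ ($j=1,2$), and $Z_{1,2}=0$ or $Z_{2,1}=0$. **Scaling.** As $n\to\infty$, $\lambda^n_i/n\to\lambda_i\in(0,\infty)$, $m^n_i/n\to m_i\in(0,\infty)$, and $k^n_{i,j}/c_n\to k_{i,j}>0$ for $(i,j)=(1,2),(2,1)$, where $c_n>0$, $c_n/n\to0$ and $c_n/\sqrt n\to\infty$. Each $k^n_{1,2}$ is an integer multiple of $1/b$. **Limit process.** For $\gamma=(q_1,q_2,z_{1,2})\in\mathbb S=[0,\infty)^2\times[0,m_2]$, let the fast-time-scale process $D(\gamma,\cdot)$ be the pure-jump Markov process on $\mathbb R$ with jumps $+1,\,+r,\,-1,\,-r$ at rates $$\lambda^{(1)}_-=\lambda_1,\quad \lambda^{(r)}_-=\mu_{1,2}z_{1,2}+\mu_{2,2}(m_2-z_{1,2})+\theta_2q_2,\quad \mu^{(1)}_-=\mu_{1,1}m_1+\theta_1q_1,\quad \mu^{(r)}_-=\lambda_2$$ when $D\le 0$, and $$\lambda^{(1)}_+=\lambda_1,\quad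 \lambda^{(r)}_+=\theta_2q_2,\quad \mu^{(1)}_+=\mu_{1,1}m_1+\mu_{1,2}z_{1,2}+\mu_{2,2}(m_2-z_{1,2})+\theta_1q_1,\quad \mu^{(r)}_+=\lambda_2$$ when $D>0$. Let $\delta_\pm(\gamma)=r(\lambda^{(r)}_\pm-\mu^{(r)}_\pm)+(\lambda^{(1)}_\pm-\mu^{(1)}_\pm)$ and $\mathbb A=\{\gamma\in\mathbb S:\delta_-(\gamma)>0>\delta_+(\gamma)\}$. **Theorem 4.3.** Let $t_0\ge0$ and, for each $n$, let $X^n_6$ evolve from time $t_0$ on as the CTMC above, starting from a random state $X^n_6(t_0)=\Gamma^n_6$ that is independent of the subsequent arrival, service and abandonment processes. Suppose that for every $K$, with probability tending to $1$ as $n\to\infty$, $\Gamma^n_6$ has $Z_{2,1}=0$, $Q_1>K$ and $Q_2>K$. If $$\Gamma^n_6/n\Rightarrow\gamma_6=(q_1,q_2,m_1,z_{1,2},0,m_2-z_{1,2})\quad\text{with }\gamma=(q_1,q_2,z_{1,2})\in\mathbb A,$$ and $D^n_{1,2}(t_0)\Rightarrow D(\gamma,0)$ in $\mathbb R$ as $n\to\infty$,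 then $$\{D^n_{1,2}(t_0+s/n):s\ge0\}\Rightarrow\{D(\gamma,s):s\ge0\}\quad\text{as } n\to\infty$$ in $\mathcal D([0,\infty),\mathbb R)$ with the Skorokhod $J_1$ topology. -/

import Mathlib

open MeasureTheory Filter Topology Set
open scoped NNReal ENNReal

noncomputable section

/-! ### Càdlàg paths on `[0, ∞)` and the Skorokhod `J₁` topology -/

/-- The space `D([0, ∞), E)`: functions that are right-continuous with left limits. -/
structure Cadlag (E : Type*) [TopologicalSpace E] where
  toFun : ℝ≥0 → E
  right_cont : ∀ t, ContinuousWithinAt toFun (Ici t) t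
  left_lim : ∀ t, ∃ l, Tendsto toFun (𝓝[<] t) (𝓝 l)

instance Cadlag.instCoeFun {E : Type*} [TopologicalSpace E] :
    CoeFun (Cadlag E) (fun _ => ℝ≥0 → E) := ⟨Cadlag.toFun⟩

/-- The path `s ↦ f (x (t₀ + s / n))`, for continuous `f`. -/
def Cadlag.expand {E F : Type*} [TopologicalSpace E] [TopologicalSpace F]
    (x : Cadlag E) (f : E → F) (hf : Continuous f) (t₀ : ℝ≥0) (n : ℕ+) : Cadlag F where
  toFun s := f (x (t₀ + s / ((n : ℕ) : ℝ≥0)))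
  right_cont t := by
    refine hf.continuousAt.comp_continuousWithinAt ?_
    have hc : ContinuousWithinAt (fun s : ℝ≥0 => t₀ + s / ((n : ℕ) : ℝ≥0)) (Ici t) t := by
      fun_prop
    refine ContinuousWithinAt.comp (f := fun s : ℝ≥0 => t₀ + s / ((n : ℕ) : ℝ≥0))
      (x.right_cont (t₀ + t / ((n : ℕ) : ℝ≥0))) hc ?_
    intro s hs
    have hs' : t ≤ s := hs
    have : t₀ + t / ((n : ℕ) : ℝ≥0) ≤ t₀ + s / ((n : ℕ) : ℝ≥0) := by gcongr
    exact this
  left_lim t := by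
    obtain ⟨l, hl⟩ := x.left_lim (t₀ + t / ((n : ℕ) : ℝ≥0))
    refine ⟨f l, (hf.tendsto l).comp (hl.comp ?_)⟩
    have hn : 0 < ((n : ℕ) : ℝ≥0) := by exact_mod_cast n.pos
    refine tendsto_nhdsWithin_iff.2 ⟨?_, ?_⟩
    · have hc : Continuous fun s : ℝ≥0 => t₀ + s / ((n : ℕ) : ℝ≥0) := by fun_prop
      exact (hc.tendsto t).mono_left nhdsWithin_le_nhds
    · filter_upwards [self_mem_nhdsWithin] with s hs
      have hs' : s < t := hs
      have : t₀ + s / ((n : ℕ) : ℝ≥0) < t₀ + t / ((n : ℕ) : ℝ≥0) := by gcongr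
      exact this

/-- Basic `J₁` neighbourhood of `x`: paths `y` that on `[0, T]` are uniformly `ε`-close to `x`
after a time change `c` (an increasing bijection of `[0, ∞)`) that is `ε`-close to the identity
on `[0, T]`. -/
def skorokhodNhd {E : Type*} [PseudoMetricSpace E] (x : Cadlag E) (T : ℝ≥0) (ε : ℝ) :
    Set (Cadlag E) :=
  {y | ∃ c : ℝ≥0 ≃o ℝ≥0, ∀ t ≤ T, dist (c t) t < ε ∧ dist (y t) (x (c t)) < ε}

/-- The Skorokhod `J₁` topology on `D([0, ∞), E)`. A sequence `y n` converges to `x` iff for all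
`T` and `ε > 0`, eventually `y n ∈ skorokhodNhd x T ε`. -/
instance Cadlag.instTopologicalSpace {E : Type*} [PseudoMetricSpace E] :
    TopologicalSpace (Cadlag E) where
  IsOpen U := ∀ x ∈ U, ∃ (T : ℝ≥0) (ε : ℝ), 0 < ε ∧ skorokhodNhd x T ε ⊆ U
  isOpen_univ := fun _ _ => ⟨0, 1, one_pos, subset_univ _⟩
  isOpen_inter := by
    intro U V hU hV x hx
    obtain ⟨T, ε, hε, h⟩ := hU x hx.1
    obtain ⟨T', ε', hε', h'⟩ := hV x hx.2
    refine ⟨max T T', min ε ε', lt_min hε hε', ?_⟩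
    rintro y ⟨c, hc⟩
    constructor
    · exact h ⟨c, fun t ht => ⟨(hc t (ht.trans (le_max_left _ _))).1.trans_le (min_le_left _ _),
        (hc t (ht.trans (le_max_left _ _))).2.trans_le (min_le_left _ _)⟩⟩
    · exact h' ⟨c, fun t ht => ⟨(hc t (ht.trans (le_max_right _ _))).1.trans_le (min_le_right _ _),
        (hc t (ht.trans (le_max_right _ _))).2.trans_le (min_le_right _ _)⟩⟩
  isOpen_sUnion := by
    intro S hS x hx
    obtain ⟨U, hU, hxU⟩ := hx
    obtain ⟨T, ε, hε, h⟩ := hS U hU x hxU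
    exact ⟨T, ε, hε, h.trans (subset_sUnion_of_mem hU)⟩

instance Cadlag.instMeasurableSpace {E : Type*} [PseudoMetricSpace E] :
    MeasurableSpace (Cadlag E) := borel _

instance Cadlag.instBorelSpace {E : Type*} [PseudoMetricSpace E] : BorelSpace (Cadlag E) := ⟨rfl⟩

/-! ### Pure-jump Markov processes -/

/-- Transition structure of a pure-jump process with finitely many kinds of events: in state `x`
an event of kind `e` happens at rate `rate e x` and moves the process to `next e x`. -/
structure JumpMechanism (E ι : Type*) where
  rate : ι → E → ℝ
  next : ι → E → E

/-- The total event rate in state `x`. -/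
def JumpMechanism.total {E ι : Type*} [Fintype ι] (G : JumpMechanism E ι) (x : E) : ℝ :=
  ∑ e, G.rate e x

/-- The information in the states `Y 0, …, Y k` and the holding times `T 0, …, T (k - 1)`. -/
@[reducible] def jumpHistory {Ω E : Type*} [MeasurableSpace E] (Y : ℕ → Ω → E) (T : ℕ → Ω → ℝ) (k : ℕ) :
    MeasurableSpace Ω :=
  (⨆ i ≤ k, MeasurableSpace.comap (Y i) inferInstance) ⊔
    ⨆ i < k, MeasurableSpace.comap (T i) inferInstance

/-- `X` is (almost surely) a non-explosive pure-jump Markov process with transition structure `G`,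
with an arbitrary random initial state: there are successive states `Y k` and holding times `T k`
such that, given `Y 0, T 0, …, T (k - 1), Y k`, the holding time `T k` is exponential with rate
`G.total (Y k)` and is independent of the next event, which is `e` with probability
`G.rate e (Y k) / G.total (Y k)`. (It is meant for rates that are nonnegative with positive
total, i.e. without absorbing states.) -/
def IsPureJumpMarkov {Ω E ι : Type*} [MeasurableSpace Ω] [MeasurableSpace E] [Fintype ι]
    (P : Measure Ω) (G : JumpMechanism E ι) (X : Ω → ℝ≥0 → E) : Prop :=
  ∃ (Y : ℕ → Ω → E) (T : ℕ → Ω → ℝ),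
    (∀ k, Measurable (Y k)) ∧ (∀ k, Measurable (T k)) ∧
    (∀ᵐ ω ∂P, ∀ k, 0 < T k ω) ∧
    (∀ᵐ ω ∂P, ∀ t : ℝ, ∃ k, t < ∑ i ∈ Finset.range k, T i ω) ∧
    (∀ᵐ ω ∂P, ∀ (k : ℕ) (t : ℝ≥0), ∑ i ∈ Finset.range k, T i ω ≤ t →
      (t : ℝ) < ∑ i ∈ Finset.range (k + 1), T i ω → X ω t = Y k ω) ∧
    ∀ (k : ℕ) (B : Set Ω), MeasurableSet[jumpHistory Y T k] B →
      ∀ t : ℝ, 0 ≤ t → ∀ C : Set E, MeasurableSet C →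
        P (B ∩ {ω | t < T k ω} ∩ {ω | Y (k + 1) ω ∈ C}) =
          ∫⁻ ω in B, ENNReal.ofReal (Real.exp (-(G.total (Y k ω) * t))) *
            ∑ e, ENNReal.ofReal (G.rate e (Y k ω) / G.total (Y k ω)) *
              C.indicator 1 (G.next e (Y k ω)) ∂P

/-! ### The X model under the FQR-T control -/

/-- Parameters that do not depend on the scale: `mu i j` is the service rate of a class-`i`
customer by a pool-`j` agent, `theta i` the abandonment rate of class `i`, and `r12`, `r21` are the
queue-ratio parameters. -/
structure XRates where
  (mu11 mu12 mu21 mu22 theta1 theta2 r12 r21 : ℝ)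

/-- Parameters of one system: arrival rates, numbers of servers, thresholds. -/
structure XSize where
  (lam1 lam2 : ℝ)
  (m1 m2 : ℕ)
  (k12 k21 : ℝ)

/-- The state `(Q₁, Q₂, Z₁₁, Z₁₂, Z₂₁, Z₂₂)`: queue lengths, and numbers `Z i j` of class-`i`
customers in service in pool `j`. -/
@[ext] structure XState where
  (q1 q2 z11 z12 z21 z22 : ℕ)

instance XState.instTopologicalSpace : TopologicalSpace XState := ⊥
instance XState.instDiscreteTopology : DiscreteTopology XState := ⟨rfl⟩
instance XState.instMeasurableSpace : MeasurableSpace XState := ⊤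

/-- The state as a vector in `ℝ⁶`. -/
def XState.toVec (x : XState) : Fin 6 → ℝ :=
  ![x.q1, x.q2, x.z11, x.z12, x.z21, x.z22]

/-- The possible states: no pool is over capacity, no agent of pool `i` is idle while queue `i`
is nonempty, and there is sharing in at most one direction. -/
def XSize.IsState (N : XSize) (x : XState) : Prop :=
  x.z11 + x.z21 ≤ N.m1 ∧ x.z12 + x.z22 ≤ N.m2 ∧
  (0 < x.q1 → x.z11 + x.z21 = N.m1) ∧ (0 < x.q2 → x.z12 + x.z22 = N.m2) ∧
  (x.z12 = 0 ∨ x.z21 = 0)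

/-- The queue difference `D₁₂ = Q₁ - k₁₂ - r₁₂ Q₂`. -/
def diff12 (p : XRates) (N : XSize) (x : XState) : ℝ := x.q1 - N.k12 - p.r12 * x.q2

/-- The queue difference `D₂₁ = r₂₁ Q₂ - k₂₁ - Q₁`. -/
def diff21 (p : XRates) (N : XSize) (x : XState) : ℝ := p.r21 * x.q2 - N.k21 - x.q1

/-- The events: class-`i` arrival, completion of a class-`i` service in pool `j`, class-`i`
abandonment. -/
inductive XEvent
  | arr1 | arr2 | srv11 | srv12 | srv21 | srv22 | abd1 | abd2
  deriving DecidableEq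

instance XEvent.instFintype : Fintype XEvent :=
  ⟨{.arr1, .arr2, .srv11, .srv12, .srv21, .srv22, .abd1, .abd2}, fun e => by cases e <;> decide⟩

/-- Routing of a newly available pool-1 agent. Here `x` is the state just before the service
completion, and `y` is `x` with the served customer removed. The agent helps class 2 if `D₂₁ > 0`
and pool 2 is not helping class 1; otherwise the agent turns to queue 1, and idles if it is
empty. -/
def route1 (p : XRates) (N : XSize) (x y : XState) : XState :=
  if 0 < diff21 p N x ∧ x.z12 = 0 ∧ 0 < x.q2 then { y with q2 := y.q2 - 1, z21 := y.z21 + 1 }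
  else if 0 < x.q1 then { y with q1 := y.q1 - 1, z11 := y.z11 + 1 }
  else y

/-- Routing of a newly available pool-2 agent: the agent helps class 1 if `D₁₂ > 0` and pool 1 is
not helping class 2; otherwise the agent turns to queue 2, and idles if it is empty. -/
def route2 (p : XRates) (N : XSize) (x y : XState) : XState :=
  if 0 < diff12 p N x ∧ x.z21 = 0 ∧ 0 < x.q1 then { y with q1 := y.q1 - 1, z12 := y.z12 + 1 }
  else if 0 < x.q2 then { y with q2 := y.q2 - 1, z22 := y.z22 + 1 }
  else y

/-- The transitions of the six-dimensional CTMC. -/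
def xMechanism (p : XRates) (N : XSize) : JumpMechanism XState XEvent where
  rate
    | .arr1, _ => N.lam1
    | .arr2, _ => N.lam2
    | .srv11, x => p.mu11 * x.z11
    | .srv12, x => p.mu12 * x.z12
    | .srv21, x => p.mu21 * x.z21
    | .srv22, x => p.mu22 * x.z22
    | .abd1, x => p.theta1 * x.q1
    | .abd2, x => p.theta2 * x.q2
  next
    | .arr1, x => if x.z11 + x.z21 < N.m1 then { x with z11 := x.z11 + 1 }
        else { x with q1 := x.q1 + 1 }
    | .arr2, x => if x.z12 + x.z22 < N.m2 then { x with z22 := x.z22 + 1 }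
        else { x with q2 := x.q2 + 1 }
    | .srv11, x => route1 p N x { x with z11 := x.z11 - 1 }
    | .srv12, x => route2 p N x { x with z12 := x.z12 - 1 }
    | .srv21, x => route1 p N x { x with z21 := x.z21 - 1 }
    | .srv22, x => route2 p N x { x with z22 := x.z22 - 1 }
    | .abd1, x => { x with q1 := x.q1 - 1 }
    | .abd2, x => { x with q2 := x.q2 - 1 }

/-- The time-expanded queue-difference path `s ↦ D₁₂(t₀ + s / n)`. -/
def expandedDiff (p : XRates) (N : XSize) (x : Cadlag XState) (t₀ : ℝ≥0) (n : ℕ+) : Cadlag ℝ :=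
  x.expand (diff12 p N) continuous_of_discreteTopology t₀ n

/-! ### The fast-time-scale process (FTSP) -/

/-- Limits of the scaled arrival rates and staffing levels. -/
structure FluidSize where
  (lam1 lam2 m1 m2 : ℝ)

/-- The three-dimensional fluid state `(q₁, q₂, z₁₂)`. -/
structure FluidState where
  (q1 q2 z12 : ℝ)

/-- The associated point `(q₁, q₂, m₁, z₁₂, 0, m₂ - z₁₂)` of `ℝ⁶`. -/
def FluidState.toVec6 (F : FluidSize) (g : FluidState) : Fin 6 → ℝ :=
  ![g.q1, g.q2, F.m1, g.z12, 0, F.m2 - g.z12]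

/-- Jumps of the FTSP: `+1`, `+r`, `-1`, `-r`. -/
inductive FTSPEvent
  | upOne | upR | downOne | downR
  deriving DecidableEq

instance FTSPEvent.instFintype : Fintype FTSPEvent :=
  ⟨{.upOne, .upR, .downOne, .downR}, fun e => by cases e <;> decide⟩

/-- Rates of the FTSP in the region `(-∞, 0]`. -/
def rateMinus (p : XRates) (F : FluidSize) (g : FluidState) : FTSPEvent → ℝ
  | .upOne => F.lam1
  | .upR => p.mu12 * g.z12 + p.mu22 * (F.m2 - g.z12) + p.theta2 * g.q2
  | .downOne => p.mu11 * F.m1 + p.theta1 * g.q1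
  | .downR => F.lam2

/-- Rates of the FTSP in the region `(0, ∞)`. -/
def ratePlus (p : XRates) (F : FluidSize) (g : FluidState) : FTSPEvent → ℝ
  | .upOne => F.lam1
  | .upR => p.theta2 * g.q2
  | .downOne =>
    p.mu11 * F.m1 + p.mu12 * g.z12 + p.mu22 * (F.m2 - g.z12) + p.theta1 * g.q1
  | .downR => F.lam2

/-- The transitions of the FTSP `D(γ, ·)`. -/
def ftspMechanism (p : XRates) (F : FluidSize) (g : FluidState) : JumpMechanism ℝ FTSPEvent where
  rate e d := if 0 < d then ratePlus p F g e else rateMinus p F g e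
  next
    | .upOne, d => d + 1
    | .upR, d => d + p.r12
    | .downOne, d => d - 1
    | .downR, d => d - p.r12

/-- The drift determined by the rates `v` of the four jumps `+1`, `+r`, `-1`, `-r`. -/
def drift (r : ℝ) (v : FTSPEvent → ℝ) : ℝ :=
  r * (v .upR - v .downR) + (v .upOne - v .downOne)

/-- The set `𝔸`: states in `[0, ∞)² × [0, m₂]` where the drift is positive in the
region `(-∞, 0]` and negative in the region `(0, ∞)`. -/
def setA (p : XRates) (F : FluidSize) : Set FluidState :=
  {g | 0 ≤ g.q1 ∧ 0 ≤ g.q2 ∧ 0 ≤ g.z12 ∧ g.z12 ≤ F.m2 ∧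
    0 < drift p.r12 (rateMinus p F g) ∧ drift p.r12 (ratePlus p F g) < 0}

end

/-! Over a bounded number of events, the queue lengths and `Z₁₂` change by a bounded amount. The
event rates divided by `n` are therefore frozen at their fluid limits, while `D₁₂` moves by steps of
order one. As long as both queues are nonempty, all agents are busy and pool 1 does not help class
2, an event changes `D₁₂` by an amount that depends only on the event and on the sign of `D₁₂`
(`diffJump`). With frozen rates `D₁₂` is thus asymptotically Markov by itself, and grouping the
eight events by jump size gives the rates of the FTSP (`sum_fluidRate_mul`).

This regime is encoded as the filter `nearFluid`. The initial state lies in it in probability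
(`probFilter_le_nearFluid`), and a single jump of positive rate preserves it
(`tendsto_nearFluid_next`). Induction on the number of jumps then suffices: no estimate over a time
interval and no uniformity in the number of jumps is needed. The thresholds exclude help from pool
1: `D₁₂` is initially tight and `k₁₂ + k₂₁ → ∞`, so `Q₁ + k₂₁ - r₁₂ Q₂ → ∞` in probability, and `r₂₁
≤ r₁₂` then gives `D₂₁ ≤ 0`.

Weak convergence is reduced to finitely many jumps as follows. Whether a step path lies in a
`J₁`-open set is decided by finitely many of its values and of its holding times, the latter rounded
to a dyadic grid (`IsSkeleton.mem_isOpen_iff`). Since the values lie in `(1/b)ℤ`, there are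
countably many such cells. Convergence of each cell probability gives, by Fatou, the open-set half
of the portmanteau theorem (`tendstoInDistribution_of_tendsto_cellIndex`), with no separate
tightness argument. The cell probabilities converge by induction over jumps
(`tendsto_measure_cellEvent`). -/

/-! ### Step paths and time changes that align their jumps. -/

/-- The path `x` takes the value `y k` on the `k`-th of the successive intervals of lengths `t k`,
which are positive and cover `[0, ∞)`. -/
structure IsSkeleton (x : ℝ≥0 → ℝ) (y t : ℕ → ℝ) : Prop where
  pos : ∀ k, 0 < t k
  unbounded : ∀ s : ℝ, ∃ k, s < ∑ i ∈ Finset.range k, t i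
  eq : ∀ (k : ℕ) (s : ℝ≥0), ∑ i ∈ Finset.range k, t i ≤ s →
    (s : ℝ) < ∑ i ∈ Finset.range (k + 1), t i → x s = y k

/-- Rescale `[0, u')` linearly onto `[0, u)` and apply `c`, suitably shifted, afterwards. -/
lemma exists_orderIso_prepend (u u' : ℝ≥0) (hu : 0 < u) (hu' : 0 < u') (c : ℝ≥0 ≃o ℝ≥0) :
    ∃ d : ℝ≥0 ≃o ℝ≥0, (∀ s < u', d s = s * (u / u')) ∧ ∀ s, u' ≤ s → d s = u + c (s - u') := by
  let f : ℝ≥0 → ℝ≥0 := fun s => if s < u' then s * (u / u') else u + c (s - u')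
  have hlt : ∀ s < u', s * (u / u') < u := fun s hs => by
    rw [← mul_div_assoc, div_lt_iff₀ hu', mul_comm]
    exact mul_lt_mul_of_pos_left hs hu
  have hmono : StrictMono f := by
    intro s s' h
    simp only [f]
    split_ifs with h1 h2 h2
    · exact mul_lt_mul_of_pos_right h (by positivity)
    · exact (hlt s h1).trans_le le_self_add
    · exact absurd (h.trans h2) h1
    · have : s - u' < s' - u' := tsub_lt_tsub_right_of_le (not_lt.1 h1) h
      simpa using c.strictMono this
  have hsurj : Function.Surjective f := by
    intro v
    by_cases hv : v < u
    · refine ⟨v * (u' / u), ?_⟩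
      have : v * (u' / u) < u' := by
        rw [← mul_div_assoc, div_lt_iff₀ hu, mul_comm]
        exact mul_lt_mul_of_pos_left hv hu'
      simp only [f, if_pos this]
      field_simp
    · refine ⟨u' + c.symm (v - u), ?_⟩
      have : ¬ u' + c.symm (v - u) < u' := not_lt.2 le_self_add
      simp only [f, if_neg this, add_tsub_cancel_left, OrderIso.apply_symm_apply]
      exact add_tsub_cancel_of_le (not_lt.1 hv)
  refine ⟨hmono.orderIsoOfSurjective f hsurj, fun s hs => ?_, fun s hs => ?_⟩
  · simp [f, hs]
  · simp [f, not_lt.2 hs]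

/-- Induction on `K`, rescaling the first interval and appending the time change for the others. The
rescaling displaces points by at most `|t 0 - t' 0|`, and later points are shifted by exactly this
difference, so the displacements add up. -/
lemma exists_timeChange (K : ℕ) (t t' : ℕ → ℝ) (ht : ∀ k, 0 < t k) (ht' : ∀ k, 0 < t' k) :
    ∃ c : ℝ≥0 ≃o ℝ≥0,
      (∀ k < K, ∀ s : ℝ≥0, ∑ i ∈ Finset.range k, t' i ≤ s →
        (s : ℝ) < ∑ i ∈ Finset.range (k + 1), t' i →
        ∑ i ∈ Finset.range k, t i ≤ c s ∧ (c s : ℝ) < ∑ i ∈ Finset.range (k + 1), t i) ∧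
      ∀ s, |(c s : ℝ) - s| ≤ ∑ i ∈ Finset.range K, |t i - t' i| := by
  induction K generalizing t t' with
  | zero => exact ⟨OrderIso.refl _, by simp, by simp⟩
  | succ K ih =>
    obtain ⟨c, hc1, hc2⟩ := ih (fun k => t (k + 1)) (fun k => t' (k + 1)) (fun k => ht _)
      (fun k => ht' _)
    obtain ⟨d, hd1, hd2⟩ := exists_orderIso_prepend ⟨t 0, (ht 0).le⟩ ⟨t' 0, (ht' 0).le⟩
      (ht 0) (ht' 0) c
    have hd1' : ∀ s : ℝ≥0, (s : ℝ) < t' 0 → (d s : ℝ) = s * (t 0 / t' 0) := fun s hs => by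
      rw [hd1 s hs]; rfl
    have hd2' : ∀ s : ℝ≥0, t' 0 ≤ (s : ℝ) → ∃ v : ℝ≥0, (v : ℝ) = s - t' 0 ∧
        (d s : ℝ) = t 0 + c v := fun s hs => by
      refine ⟨s - ⟨t' 0, (ht' 0).le⟩, NNReal.coe_sub hs, ?_⟩
      rw [hd2 s hs]; rfl
    have h0 := ht 0
    have h0' := ht' 0
    refine ⟨d, ?_, ?_⟩
    · intro k hk s hs1 hs2
      cases k with
      | zero =>
        simp only [zero_add, Finset.range_one, Finset.sum_singleton, Finset.range_zero,
          Finset.sum_empty] at hs1 hs2 ⊢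
        rw [hd1' s hs2]
        refine ⟨by positivity, ?_⟩
        rw [← mul_div_assoc, div_lt_iff₀ h0', mul_comm]
        exact mul_lt_mul_of_pos_left hs2 h0
      | succ k =>
        rw [Finset.sum_range_succ'] at hs1 hs2 ⊢
        rw [Finset.sum_range_succ' t]
        have hnn : 0 ≤ ∑ i ∈ Finset.range k, t' (i + 1) :=
          Finset.sum_nonneg fun i _ => (ht' _).le
        obtain ⟨v, hv, hdv⟩ := hd2' s (by linarith)
        have := hc1 k (by omega) v (by linarith) (by linarith)
        constructor <;> linarith [this.1, this.2]
    · intro s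
      rw [Finset.sum_range_succ']
      have hnn : 0 ≤ ∑ i ∈ Finset.range K, |t (i + 1) - t' (i + 1)| :=
        Finset.sum_nonneg fun i _ => abs_nonneg _
      rcases lt_or_ge (s : ℝ) (t' 0) with hs | hs
      · rw [hd1' s hs]
        have h1 : (s : ℝ) * (t 0 / t' 0) - s = (s / t' 0) * (t 0 - t' 0) := by field_simp
        have h2 : (s : ℝ) / t' 0 ≤ 1 := by rw [div_le_one h0']; exact hs.le
        rw [h1, abs_mul, abs_of_nonneg (by positivity : 0 ≤ (s : ℝ) / t' 0)]
        nlinarith [abs_nonneg (t 0 - t' 0)]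
      · obtain ⟨v, hv, hdv⟩ := hd2' s hs
        have : (d s : ℝ) - s = ((c v : ℝ) - v) + (t 0 - t' 0) := by rw [hdv, hv]; ring
        rw [this]
        exact (abs_add_le _ _).trans (by linarith [hc2 v])

/-- Paths whose first values agree and whose first holding times are close, are close. -/
lemma IsSkeleton.exists_mem_skorokhodNhd {x : Cadlag ℝ} {y t : ℕ → ℝ} (h : IsSkeleton x y t)
    (S : ℝ≥0) {ε : ℝ} (hε : 0 < ε) :
    ∃ m : ℕ, ∀ (x' : Cadlag ℝ) (y' t' : ℕ → ℝ), IsSkeleton x' y' t' → (∀ i ≤ m, y' i = y i) →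
      (∀ i < m, ⌈2 ^ m * t' i⌉₊ = ⌈2 ^ m * t i⌉₊) → x' ∈ skorokhodNhd x S ε := by
  -- The extra `1` is a margin: the first `K` holding times of the other path then still cover `[0,
  -- S]`.
  obtain ⟨K, hK⟩ := h.unbounded (S + 1)
  have hlim : Tendsto (fun m : ℕ => (K : ℝ) * (1 / 2) ^ m) atTop (𝓝 0) := by
    simpa using (tendsto_pow_atTop_nhds_zero_of_lt_one (r := (1 / 2 : ℝ)) (by norm_num)
      (by norm_num)).const_mul (K : ℝ)
  -- A single `m` bounds both the number of controlled jumps (`K ≤ m`) and the rounding error: the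
  -- `K` errors of size `2 ^ (-m)` sum to less than `min ε 1`.
  obtain ⟨m, hm, hmK⟩ := ((hlim.eventually (gt_mem_nhds (lt_min hε one_pos))).and
    (eventually_ge_atTop K)).exists
  refine ⟨m, fun x' y' t' h' hy hceil => ?_⟩
  have hclose : ∀ i < K, |t i - t' i| ≤ (1 / 2) ^ m := by
    intro i hi
    have h2 : (0 : ℝ) < 2 ^ m := by positivity
    have e := hceil i (by omega)
    have a1 := Nat.le_ceil (2 ^ m * t' i)
    have a2 := Nat.ceil_lt_add_one (a := 2 ^ m * t' i) (by have := h'.pos i; positivity)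
    have b1 := Nat.le_ceil (2 ^ m * t i)
    have b2 := Nat.ceil_lt_add_one (a := 2 ^ m * t i) (by have := h.pos i; positivity)
    rw [e] at a1 a2
    rw [one_div, inv_pow, ← one_div, le_div_iff₀ h2]
    rcases abs_cases (t i - t' i) with ⟨hab, -⟩ | ⟨hab, -⟩ <;> rw [hab] <;> linarith
  obtain ⟨c, hc1, hc2⟩ := exists_timeChange K t t' h.pos h'.pos
  have hsum : ∑ i ∈ Finset.range K, |t i - t' i| ≤ K * (1 / 2) ^ m := by
    refine (Finset.sum_le_sum fun i hi => hclose i (Finset.mem_range.1 hi)).trans ?_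
    simp
  have hK' : (S : ℝ) < ∑ i ∈ Finset.range K, t' i := by
    have : ∑ i ∈ Finset.range K, t i - ∑ i ∈ Finset.range K, t' i ≤
        ∑ i ∈ Finset.range K, |t i - t' i| := by
      rw [← Finset.sum_sub_distrib]
      exact Finset.sum_le_sum fun i _ => le_abs_self _
    linarith [hm.trans_le (min_le_right ε 1)]
  refine ⟨c, fun s hs => ?_⟩
  have hdist : dist (c s) s < ε := by
    rw [NNReal.dist_eq]
    exact ((hc2 s).trans hsum).trans_lt (hm.trans_le (min_le_left _ _))
  refine ⟨hdist, ?_⟩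
  have hex : ∃ k, (s : ℝ) < ∑ i ∈ Finset.range (k + 1), t' i := by
    refine ⟨K, (lt_of_le_of_lt (by exact_mod_cast hs) hK').trans_le ?_⟩
    rw [Finset.sum_range_succ]
    linarith [h'.pos K]
  classical
  obtain ⟨k, hk1, hk2⟩ : ∃ k, ∑ i ∈ Finset.range k, t' i ≤ s ∧
      (s : ℝ) < ∑ i ∈ Finset.range (k + 1), t' i := by
    refine ⟨Nat.find hex, ?_, Nat.find_spec hex⟩
    rcases Nat.eq_zero_or_eq_succ_pred (Nat.find hex) with h0 | h0
    · rw [h0]; simp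
    · have := Nat.find_min hex (m := (Nat.find hex).pred) (by omega)
      rw [h0]
      exact not_lt.1 this
  have hkK : k < K := by
    by_contra hcon
    have hle : ∑ i ∈ Finset.range K, t' i ≤ ∑ i ∈ Finset.range k, t' i :=
      Finset.sum_le_sum_of_subset_of_nonneg (Finset.range_mono (not_lt.1 hcon))
        fun i _ _ => (h'.pos i).le
    have : (s : ℝ) ≤ S := by exact_mod_cast hs
    linarith
  obtain ⟨e1, e2⟩ := hc1 k hkK s hk1 hk2
  rw [h'.eq k s hk1 hk2, h.eq k (c s) e1 e2, hy k (by omega), dist_self]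
  exact hε

/-! ### Countable families of cells that exhaust open sets of step paths. -/

/-- The first values, and the first holding times rounded up to multiples of `2 ^ (-m)`. -/
noncomputable def cellIndex (m : ℕ) (i : ℕ → ℤ) (t : ℕ → ℝ) : (Fin (m + 1) → ℤ) × (Fin m → ℕ) :=
  (fun k => i k, fun k => ⌈2 ^ m * t k⌉₊)

/-- Dyadic intervals `(q, q + 1]` are nested, so cells refine as `m` grows. -/
lemma Nat.ceil_eq_of_ceil_two_mul_eq {a b : ℝ} (h : ⌈2 * a⌉₊ = ⌈2 * b⌉₊) : ⌈a⌉₊ = ⌈b⌉₊ := by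
  have key : ∀ (c : ℝ) (n : ℕ), ⌈c⌉₊ ≤ n ↔ ⌈2 * c⌉₊ ≤ 2 * n := fun c n => by
    rw [Nat.ceil_le, Nat.ceil_le]
    push_cast
    constructor <;> intro h <;> linarith
  refine le_antisymm ?_ ?_
  · rw [key, h, ← key]
  · rw [key, ← h, ← key]

lemma cellIndex_eq_of_succ {m : ℕ} {i i' : ℕ → ℤ} {t t' : ℕ → ℝ}
    (h : cellIndex (m + 1) i t = cellIndex (m + 1) i' t') :
    cellIndex m i t = cellIndex m i' t' := by
  simp only [cellIndex, Prod.mk.injEq, funext_iff] at h ⊢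
  refine ⟨fun k => h.1 k.castSucc, fun k => Nat.ceil_eq_of_ceil_two_mul_eq ?_⟩
  have := h.2 k.castSucc
  simpa only [pow_succ', mul_assoc, Fin.val_castSucc] using this

/-- The cells all of whose paths lie in `U`. -/
def cellsIn (v : ℤ → ℝ) (U : Set (Cadlag ℝ)) (m : ℕ) : Set ((Fin (m + 1) → ℤ) × (Fin m → ℕ)) :=
  {j | ∀ (x : Cadlag ℝ) (i : ℕ → ℤ) (t : ℕ → ℝ), IsSkeleton x (fun k => v (i k)) t →
    cellIndex m i t = j → x ∈ U}

lemma mem_cellsIn_succ {v : ℤ → ℝ} {U : Set (Cadlag ℝ)} {m : ℕ} {i : ℕ → ℤ} {t : ℕ → ℝ}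
    (h : cellIndex m i t ∈ cellsIn v U m) : cellIndex (m + 1) i t ∈ cellsIn v U (m + 1) :=
  fun x i' t' hx hc => h x i' t' hx (cellIndex_eq_of_succ hc)

/-- An open set contains a basic `J₁` neighbourhood of each of its points, and that neighbourhood
contains all step paths of a sufficiently fine cell. Conversely, a path lies in its own cell. -/
lemma IsSkeleton.mem_isOpen_iff {v : ℤ → ℝ} {U : Set (Cadlag ℝ)} (hU : IsOpen U) {x : Cadlag ℝ}
    {i : ℕ → ℤ} {t : ℕ → ℝ} (h : IsSkeleton x (fun k => v (i k)) t) :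
    x ∈ U ↔ ∃ m, cellIndex m i t ∈ cellsIn v U m := by
  constructor
  · intro hx
    obtain ⟨S, ε, hε, hsub⟩ := hU x hx
    obtain ⟨m, hm⟩ := h.exists_mem_skorokhodNhd S hε
    refine ⟨m, fun x' i' t' hx' hc => hsub (hm x' _ t' hx' ?_ ?_)⟩
    · intro k hk
      have := congrFun (congrArg Prod.fst hc) ⟨k, by omega⟩
      exact congrArg v this
    · intro k hk
      exact congrFun (congrArg Prod.snd hc) ⟨k, hk⟩
  · rintro ⟨m, hm⟩
    exact hm x i t h rfl

lemma measurable_cellIndex {Ω : Type*} [MeasurableSpace Ω] {i : ℕ → Ω → ℤ} {t : ℕ → Ω → ℝ}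
    (hi : ∀ k, Measurable (i k)) (ht : ∀ k, Measurable (t k)) (m : ℕ) :
    Measurable fun ω => cellIndex m (fun k => i k ω) (fun k => t k ω) := by
  refine Measurable.prodMk (measurable_pi_lambda _ fun k => hi k) (measurable_pi_lambda _ fun k => ?_)
  exact Nat.measurable_ceil.comp ((ht k).const_mul _)

/-- Off a null set, the preimage of an open set is a countable union of cell events. On the null set
the path is replaced by a fixed one. -/
lemma aemeasurable_of_isSkeleton {Ω : Type*} [MeasurableSpace Ω] {P : Measure Ω}
    [IsProbabilityMeasure P] {v : ℤ → ℝ} {x : Ω → Cadlag ℝ} {i : ℕ → Ω → ℤ} {t : ℕ → Ω → ℝ}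
    (hi : ∀ k, Measurable (i k)) (ht : ∀ k, Measurable (t k))
    (h : ∀ᵐ ω ∂P, IsSkeleton (x ω) (fun k => v (i k ω)) fun k => t k ω) : AEMeasurable x P := by
  obtain ⟨A, hA, hAm, hA0⟩ := exists_measurable_superset_of_null (ae_iff.1 h)
  have hsk : ∀ ω, ω ∉ A → IsSkeleton (x ω) (fun k => v (i k ω)) fun k => t k ω := fun ω hω => by
    by_contra hcon
    exact hω (hA hcon)
  obtain ⟨ω₀⟩ := nonempty_of_isProbabilityMeasure P
  classical
  refine ⟨fun ω => if ω ∈ A then x ω₀ else x ω, ?_, ?_⟩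
  · refine measurable_of_isOpen fun U hU => ?_
    have : (fun ω => if ω ∈ A then x ω₀ else x ω) ⁻¹' U = (A ∩ {_ω | x ω₀ ∈ U}) ∪
        (Aᶜ ∩ ⋃ m, (fun ω => cellIndex m (fun k => i k ω) (fun k => t k ω)) ⁻¹' cellsIn v U m) := by
      ext ω
      by_cases hω : ω ∈ A
      · simp [hω]
      · simp [hω, (hsk ω hω).mem_isOpen_iff hU]
    rw [this]
    refine (hAm.inter (MeasurableSet.const _)).union (hAm.compl.inter (MeasurableSet.iUnion fun m =>
      measurable_cellIndex hi ht m (Set.to_countable _).measurableSet))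
  · have : ∀ᵐ ω ∂P, ω ∉ A := measure_eq_zero_iff_ae_notMem.1 hA0
    filter_upwards [this] with ω hω
    simp [hω]

/-! ### From cell probabilities to weak convergence. -/

/-- Fatou's lemma for the laws of random variables in a countable space. -/
lemma measure_preimage_le_liminf_of_tendsto_singleton {ι κ Ω' : Type*} {l : Filter ι}
    {Ω : ι → Type*} [∀ n, MeasurableSpace (Ω n)] [MeasurableSpace Ω'] [Countable κ]
    [MeasurableSpace κ] [MeasurableSingletonClass κ] {P : ∀ n, Measure (Ω n)} {P' : Measure Ω'}
    {f : ∀ n, Ω n → κ} {f' : Ω' → κ} (hf : ∀ n, Measurable (f n)) (hf' : Measurable f')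
    (h : ∀ j, Tendsto (fun n => P n {ω | f n ω = j}) l (𝓝 (P' {ω | f' ω = j}))) (J : Set κ) :
    P' (f' ⁻¹' J) ≤ l.liminf fun n => P n (f n ⁻¹' J) := by
  rcases l.eq_or_neBot with rfl | hl
  · simp
  have hJ : MeasurableSet J := (Set.to_countable _).measurableSet
  rw [← Measure.map_apply hf' hJ, ← Measure.tsum_indicator_apply_singleton _ _ hJ,
    ENNReal.tsum_eq_iSup_sum]
  refine iSup_le fun s => ?_
  have hlim : Tendsto (fun n => ∑ j ∈ s, J.indicator (fun j => (P n).map (f n) {j}) j) l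
      (𝓝 (∑ j ∈ s, J.indicator (fun j => P'.map f' {j}) j)) := by
    refine tendsto_finsetSum _ fun j _ => ?_
    by_cases hj : j ∈ J
    · simp only [indicator_of_mem hj, Measure.map_apply hf' (measurableSet_singleton j),
        fun n => Measure.map_apply (μ := P n) (hf n) (measurableSet_singleton j)]
      exact h j
    · simp [indicator_of_notMem hj]
  rw [← hlim.liminf_eq]
  refine liminf_le_liminf (Eventually.of_forall fun n => ?_)
  rw [← Measure.map_apply (hf n) hJ, ← Measure.tsum_indicator_apply_singleton _ _ hJ]
  exact ENNReal.sum_le_tsum _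

/-- Convergence in distribution of step processes from convergence of the probabilities of all
cells. -/
theorem tendstoInDistribution_of_tendsto_cellIndex {ι Ω' : Type*} {l : Filter ι}
    [l.IsCountablyGenerated] {Ω : ι → Type*} [∀ n, MeasurableSpace (Ω n)] [MeasurableSpace Ω']
    (P : ∀ n, Measure (Ω n)) [∀ n, IsProbabilityMeasure (P n)] (P' : Measure Ω')
    [IsProbabilityMeasure P'] (v : ℤ → ℝ) {x : ∀ n, Ω n → Cadlag ℝ} {i : ∀ n, ℕ → Ω n → ℤ}
    {t : ∀ n, ℕ → Ω n → ℝ} {x' : Ω' → Cadlag ℝ} {i' : ℕ → Ω' → ℤ} {t' : ℕ → Ω' → ℝ}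
    (hi : ∀ n k, Measurable (i n k)) (ht : ∀ n k, Measurable (t n k))
    (hx : ∀ n, ∀ᵐ ω ∂P n, IsSkeleton (x n ω) (fun k => v (i n k ω)) fun k => t n k ω)
    (hi' : ∀ k, Measurable (i' k)) (ht' : ∀ k, Measurable (t' k))
    (hx' : ∀ᵐ ω ∂P', IsSkeleton (x' ω) (fun k => v (i' k ω)) fun k => t' k ω)
    (h : ∀ m j, Tendsto
      (fun n => P n {ω | cellIndex m (fun k => i n k ω) (fun k => t n k ω) = j}) l
      (𝓝 (P' {ω | cellIndex m (fun k => i' k ω) (fun k => t' k ω) = j}))) :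
    TendstoInDistribution x l x' P P' := by
  have hm := fun n => aemeasurable_of_isSkeleton (hi n) (ht n) (hx n)
  have hm' := aemeasurable_of_isSkeleton hi' ht' hx'
  refine ⟨hm, hm', tendsto_of_forall_isOpen_le_liminf' fun U hU => ?_⟩
  simp only [ProbabilityMeasure.coe_mk]
  rw [Measure.map_apply_of_aemeasurable hm' hU.measurableSet]
  simp only [fun n => Measure.map_apply_of_aemeasurable (hm n) hU.measurableSet]
  have e' : x' ⁻¹' U =ᵐ[P']
      ⋃ m, {ω | cellIndex m (fun k => i' k ω) (fun k => t' k ω) ∈ cellsIn v U m} := by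
    filter_upwards [hx'] with ω hω
    refine propext ((hω.mem_isOpen_iff hU).trans ?_)
    exact (mem_iUnion (s := fun m =>
      {ω | cellIndex m (fun k => i' k ω) (fun k => t' k ω) ∈ cellsIn v U m})).symm
  have hmono : Monotone
      fun m => {ω | cellIndex m (fun k => i' k ω) (fun k => t' k ω) ∈ cellsIn v U m} :=
    monotone_nat_of_le_succ fun m ω hω => mem_cellsIn_succ hω
  rw [measure_congr e', hmono.measure_iUnion]
  refine iSup_le fun m => (measure_preimage_le_liminf_of_tendsto_singleton
    (fun n => measurable_cellIndex (hi n) (ht n) m) (measurable_cellIndex hi' ht' m) (h m)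
    (cellsIn v U m)).trans (liminf_le_liminf (Eventually.of_forall fun n => ?_))
  -- All step paths of a cell in `cellsIn v U m` lie in `U`, so this inclusion holds for every `n`
  -- with the same cells.
  refine measure_mono_ae ?_
  filter_upwards [hx n] with ω hω hc
  exact (hω.mem_isOpen_iff hU).2 ⟨m, hc⟩

/-! ### One-step laws of pure-jump processes. -/

section JumpLaw

variable {Ω E ι : Type*} [Fintype ι]

/-- The chance that a jump from `x` happens after time `t` and leads into `C`. -/
noncomputable def JumpMechanism.stepProb (G : JumpMechanism E ι) (t : ℝ) (C : Set E) (x : E) : ℝ :=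
  Real.exp (-(G.total x * t)) * ∑ e, G.rate e x / G.total x * C.indicator 1 (G.next e x)

lemma JumpMechanism.stepProb_nonneg {G : JumpMechanism E ι} {x : E} (h : ∀ e, 0 ≤ G.rate e x)
    (t : ℝ) (C : Set E) : 0 ≤ G.stepProb t C x := by
  have : 0 ≤ G.total x := Finset.sum_nonneg fun e _ => h e
  refine mul_nonneg (Real.exp_pos _).le (Finset.sum_nonneg fun e _ => mul_nonneg
    (div_nonneg (h e) this) (indicator_nonneg (fun _ _ => zero_le_one) _))

lemma JumpMechanism.stepProb_le_one {G : JumpMechanism E ι} {x : E} (h : ∀ e, 0 ≤ G.rate e x)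
    {t : ℝ} (ht : 0 ≤ t) (C : Set E) : G.stepProb t C x ≤ 1 := by
  have h0 : 0 ≤ G.total x := Finset.sum_nonneg fun e _ => h e
  have h1 : ∑ e, G.rate e x / G.total x * C.indicator 1 (G.next e x) ≤ 1 := by
    calc ∑ e, G.rate e x / G.total x * C.indicator 1 (G.next e x)
        ≤ ∑ e, G.rate e x / G.total x := by
          refine Finset.sum_le_sum fun e _ => mul_le_of_le_one_right (div_nonneg (h e) h0) ?_
          exact indicator_le' (fun _ _ => le_rfl) (fun _ _ => zero_le_one) _
      _ = G.total x / G.total x := by rw [← Finset.sum_div]; rfl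
      _ ≤ 1 := div_self_le_one _
  refine mul_le_one₀ (Real.exp_le_one_iff.2 (by nlinarith)) ?_ h1
  exact Finset.sum_nonneg fun e _ => mul_nonneg (div_nonneg (h e) h0)
    (indicator_nonneg (fun _ _ => zero_le_one) _)
variable [MeasurableSpace E]

lemma measurable_jumpHistory_state {Y : ℕ → Ω → E} {T : ℕ → Ω → ℝ} {i k : ℕ} (h : i ≤ k) :
    Measurable[jumpHistory Y T k] (Y i) := by
  have : MeasurableSpace.comap (Y i) inferInstance ≤ jumpHistory Y T k :=
    le_sup_of_le_left (le_iSup₂_of_le (f := fun i (_ : i ≤ k) =>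
      MeasurableSpace.comap (Y i) inferInstance) i h le_rfl)
  exact (comap_measurable (Y i)).mono this le_rfl

lemma measurable_jumpHistory_time {Y : ℕ → Ω → E} {T : ℕ → Ω → ℝ} {i k : ℕ} (h : i < k) :
    Measurable[jumpHistory Y T k] (T i) := by
  have : MeasurableSpace.comap (T i) inferInstance ≤ jumpHistory Y T k :=
    le_sup_of_le_right (le_iSup₂_of_le (f := fun i (_ : i < k) =>
      MeasurableSpace.comap (T i) inferInstance) i h le_rfl)
  exact (comap_measurable (T i)).mono this le_rfl

variable [MeasurableSpace Ω]

/-- The conditional law of holding times and successive states in `IsPureJumpMarkov`. -/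
def HasJumpLaw (P : Measure Ω) (G : JumpMechanism E ι) (Y : ℕ → Ω → E) (T : ℕ → Ω → ℝ) : Prop :=
  ∀ (k : ℕ) (B : Set Ω), MeasurableSet[jumpHistory Y T k] B →
    ∀ t : ℝ, 0 ≤ t → ∀ C : Set E, MeasurableSet C →
      P (B ∩ {ω | t < T k ω} ∩ {ω | Y (k + 1) ω ∈ C}) =
        ∫⁻ ω in B, ENNReal.ofReal (Real.exp (-(G.total (Y k ω) * t))) *
          ∑ e, ENNReal.ofReal (G.rate e (Y k ω) / G.total (Y k ω)) *
            C.indicator 1 (G.next e (Y k ω)) ∂P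

lemma HasJumpLaw.measure_eq_lintegral_stepProb {P : Measure Ω} {G : JumpMechanism E ι}
    {Y : ℕ → Ω → E} {T : ℕ → Ω → ℝ} (h : HasJumpLaw P G Y T) {k : ℕ} {B : Set Ω}
    (hB : MeasurableSet[jumpHistory Y T k] B) {t : ℝ} (ht : 0 ≤ t) {C : Set E}
    (hC : MeasurableSet C) (hG : ∀ e x, 0 ≤ G.rate e x) :
    P (B ∩ {ω | t < T k ω} ∩ {ω | Y (k + 1) ω ∈ C}) =
      ∫⁻ ω in B, ENNReal.ofReal (G.stepProb t C (Y k ω)) ∂P := by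
  rw [h k B hB t ht C hC]
  refine lintegral_congr fun ω => ?_
  have h0 : 0 ≤ G.total (Y k ω) := Finset.sum_nonneg fun e _ => hG e _
  have hi : ∀ z, 0 ≤ C.indicator (1 : E → ℝ) z := indicator_nonneg fun _ _ => zero_le_one
  rw [JumpMechanism.stepProb, ENNReal.ofReal_mul (Real.exp_pos _).le,
    ENNReal.ofReal_sum_of_nonneg fun e _ => mul_nonneg (div_nonneg (hG e _) h0) (hi _)]
  congr 1
  refine Finset.sum_congr rfl fun e _ => ?_
  rw [ENNReal.ofReal_mul (div_nonneg (hG e _) h0)]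
  congr 1
  by_cases hz : G.next e (Y k ω) ∈ C <;> simp [hz]

/-- Almost surely, each jump is one that has positive rate. -/
lemma HasJumpLaw.measure_jump_eq_zero {P : Measure Ω} {G : JumpMechanism E ι} {Y : ℕ → Ω → E}
    {T : ℕ → Ω → ℝ} (h : HasJumpLaw P G Y T) (hYm : ∀ k, Measurable (Y k))
    (hT : ∀ᵐ ω ∂P, ∀ k, 0 < T k ω) {S S' : Set E}
    (hS : MeasurableSet S) (hS' : MeasurableSet S')
    (hstep : ∀ x ∈ S, ∀ e, G.rate e x ≠ 0 → G.next e x ∈ S') (k : ℕ) :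
    P {ω | Y k ω ∈ S ∧ Y (k + 1) ω ∉ S'} = 0 := by
  have hB : MeasurableSet[jumpHistory Y T k] (Y k ⁻¹' S) :=
    measurable_jumpHistory_state le_rfl hS
  -- At time `0` the condition on the holding time is almost surely void, which leaves the law of
  -- the next state.
  have h1 := h k _ hB 0 le_rfl S'ᶜ hS'.compl
  have h2 : ∫⁻ ω in Y k ⁻¹' S, ENNReal.ofReal (Real.exp (-(G.total (Y k ω) * 0))) *
      ∑ e, ENNReal.ofReal (G.rate e (Y k ω) / G.total (Y k ω)) *
        S'ᶜ.indicator 1 (G.next e (Y k ω)) ∂P = 0 := by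
    rw [setLIntegral_congr_fun (g := fun _ => 0) (hYm k hS), lintegral_zero]
    intro ω hω
    simp only
    rw [Finset.sum_eq_zero, mul_zero]
    intro e _
    by_cases hr : G.rate e (Y k ω) = 0
    · simp [hr]
    · simp [hstep _ hω e hr]
  rw [← nonpos_iff_eq_zero, ← h2, ← h1]
  refine measure_mono_ae ?_
  filter_upwards [hT] with ω hω hmem
  exact ⟨⟨hmem.1, hω k⟩, hmem.2⟩

lemma HasJumpLaw.ae_forall_mem {P : Measure Ω} {G : JumpMechanism E ι} {Y : ℕ → Ω → E}
    {T : ℕ → Ω → ℝ} (h : HasJumpLaw P G Y T) (hYm : ∀ k, Measurable (Y k))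
    (hT : ∀ᵐ ω ∂P, ∀ k, 0 < T k ω) {S : Set E} (hS : MeasurableSet S)
    (hstep : ∀ x ∈ S, ∀ e, G.next e x ∈ S) (h0 : ∀ᵐ ω ∂P, Y 0 ω ∈ S) :
    ∀ᵐ ω ∂P, ∀ k, Y k ω ∈ S := by
  refine ae_all_iff.2 fun k => ?_
  induction k with
  | zero => exact h0
  | succ k ih =>
    have := h.measure_jump_eq_zero hYm hT hS hS (fun x hx e _ => hstep x hx e) k
    filter_upwards [ih, measure_eq_zero_iff_ae_notMem.1 this] with ω h1 h2
    by_contra hcon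
    exact h2 ⟨h1, hcon⟩

end JumpLaw

/-! ### Convergence in probability as a filter on pairs of index and state. -/

section InProbability

variable {κ E : Type*} {Ω : κ → Type*} [∀ n, MeasurableSpace (Ω n)]

/-- The filter of the sets in which `(n, Y n)` lies with probability tending to one. -/
def probFilter (l : Filter κ) (P : ∀ n, Measure (Ω n)) (Y : ∀ n, Ω n → E) : Filter (κ × E) where
  sets := {S | Tendsto (fun n => P n {ω | (n, Y n ω) ∉ S}) l (𝓝 0)}
  univ_sets := by simpa using tendsto_const_nhds
  sets_of_superset {S S'} h hS := tendsto_of_tendsto_of_tendsto_of_le_of_le tendsto_const_nhds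
    (show Tendsto (fun n => P n {ω | (n, Y n ω) ∉ S}) l (𝓝 0) from h) (fun _ => zero_le)
    fun n => measure_mono fun ω hω hmem => hω (hS hmem)
  inter_sets {S S'} h h' := by
    have h2 : Tendsto (fun n => P n {ω | (n, Y n ω) ∉ S} + P n {ω | (n, Y n ω) ∉ S'}) l (𝓝 0) := by
      simpa using Tendsto.add (show Tendsto (fun n => P n {ω | (n, Y n ω) ∉ S}) l (𝓝 0) from h)
        (show Tendsto (fun n => P n {ω | (n, Y n ω) ∉ S'}) l (𝓝 0) from h')
    refine tendsto_of_tendsto_of_tendsto_of_le_of_le tendsto_const_nhds h2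
      (fun _ => zero_le) fun n => (measure_mono fun ω hω => ?_).trans (measure_union_le _ _)
    by_contra hcon
    simp only [mem_union, mem_ofPred_eq, not_or, not_not] at hcon
    exact hω hcon

lemma mem_probFilter {l : Filter κ} {P : ∀ n, Measure (Ω n)} {Y : ∀ n, Ω n → E}
    {S : Set (κ × E)} :
    S ∈ probFilter l P Y ↔ Tendsto (fun n => P n {ω | (n, Y n ω) ∉ S}) l (𝓝 0) := Iff.rfl

variable [MeasurableSpace E] {ι : Type*} [Fintype ι]

/-- Jumps of rate zero are null, so the next state can miss `S` only if the present one already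
misses the set from which all possible jumps lead into `S`. That set belongs to `𝓖`. -/
lemma probFilter_succ_le [DiscreteMeasurableSpace E] {l : Filter κ} {P : ∀ n, Measure (Ω n)}
    {G : κ → JumpMechanism E ι}
    {Y : ∀ n, ℕ → Ω n → E} {T : ∀ n, ℕ → Ω n → ℝ} (h : ∀ n, HasJumpLaw (P n) (G n) (Y n) (T n))
    (hYm : ∀ n k, Measurable (Y n k)) (hT : ∀ n, ∀ᵐ ω ∂P n, ∀ k, 0 < T n k ω)
    {𝓖 : Filter (κ × E)}
    (h𝓖 : ∀ S ∈ 𝓖, ∀ᶠ p in 𝓖, ∀ e, (G p.1).rate e p.2 ≠ 0 → (p.1, (G p.1).next e p.2) ∈ S)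
    {k : ℕ} (hk : probFilter l P (fun n => Y n k) ≤ 𝓖) :
    probFilter l P (fun n => Y n (k + 1)) ≤ 𝓖 := by
  intro S hS
  have h1 := mem_probFilter.1 (hk (h𝓖 S hS))
  refine tendsto_of_tendsto_of_tendsto_of_le_of_le tendsto_const_nhds h1 (fun _ => zero_le)
    fun n => ?_
  have h2 := (h n).measure_jump_eq_zero (hYm n) (hT n)
    (S := {x | ∀ e, (G n).rate e x ≠ 0 → (n, (G n).next e x) ∈ S}) (S' := {x | (n, x) ∈ S})
    (MeasurableSet.of_discrete) (MeasurableSet.of_discrete) (fun x hx e he => hx e he) k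
  refine measure_mono_ae ?_
  filter_upwards [measure_eq_zero_iff_ae_notMem.1 h2] with ω hω hmem hcon
  exact hω ⟨hcon, hmem⟩

/-- Bounded convergence in probability: outside an event of vanishing probability the integrand on
`B n` is within `δ / 2` of `c`, and on that event the difference is at most `1 + |c|`. The set `R`
allows a limit that is valid only for a prescribed value of a function of the state. -/
lemma tendsto_setLIntegral_of_probFilter_le [DiscreteMeasurableSpace E] {l : Filter κ}
    {P : ∀ n, Measure (Ω n)} [∀ n, IsProbabilityMeasure (P n)] {Y : ∀ n, Ω n → E}
    (hYm : ∀ n, Measurable (Y n)) {𝓖 : Filter (κ × E)} (hY : probFilter l P Y ≤ 𝓖)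
    {φ : κ → E → ℝ} (hφ0 : ∀ n x, 0 ≤ φ n x) (hφ1 : ∀ n x, φ n x ≤ 1) {R : Set (κ × E)} {c : ℝ}
    (hc : 0 ≤ c)
    (hφ : Tendsto (fun p : κ × E => φ p.1 p.2) (𝓖 ⊓ 𝓟 R) (𝓝 c)) {B : ∀ n, Set (Ω n)}
    (hBm : ∀ n, MeasurableSet (B n)) (hBR : ∀ n, ∀ ω ∈ B n, (n, Y n ω) ∈ R) {β : ℝ≥0∞}
    (hβ : β ≠ ∞) (hB : Tendsto (fun n => P n (B n)) l (𝓝 β)) :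
    Tendsto (fun n => ∫⁻ ω in B n, ENNReal.ofReal (φ n (Y n ω)) ∂P n) l
      (𝓝 (ENNReal.ofReal c * β)) := by
  have hmeas : ∀ n, Measurable fun ω => φ n (Y n ω) := fun n =>
    (Measurable.of_discrete (f := φ n)).comp (hYm n)
  have hint : ∀ n (A : Set (Ω n)), IntegrableOn (fun ω => φ n (Y n ω)) A (P n) := fun n A => by
    refine Integrable.of_bound (hmeas n).aestronglyMeasurable 1 (ae_of_all _ fun ω => ?_)
    rw [Real.norm_of_nonneg (hφ0 _ _)]
    exact hφ1 _ _
  have hBr : Tendsto (fun n => (P n).real (B n)) l (𝓝 β.toReal) :=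
    (ENNReal.tendsto_toReal hβ).comp hB
  have hdiff : Tendsto (fun n => ∫ ω in B n, (φ n (Y n ω) - c) ∂P n) l (𝓝 0) := by
    rw [Metric.tendsto_nhds]
    intro δ hδ
    have hS : {p : κ × E | p ∈ R → |φ p.1 p.2 - c| < δ / 2} ∈ 𝓖 := by
      have := hφ.eventually (Metric.ball_mem_nhds c (half_pos hδ))
      rw [eventually_inf_principal] at this
      exact this
    have hbad := mem_probFilter.1 (hY hS)
    have hbadr : Tendsto (fun n => (1 + |c|) * (P n).real {ω | (n, Y n ω) ∉
        {p : κ × E | p ∈ R → |φ p.1 p.2 - c| < δ / 2}}) l (𝓝 0) := by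
      have := ((ENNReal.tendsto_toReal ENNReal.zero_ne_top).comp hbad).const_mul (1 + |c|)
      rw [ENNReal.toReal_zero, mul_zero] at this
      exact this
    filter_upwards [hbadr.eventually (gt_mem_nhds (half_pos hδ))] with n hn
    change (1 + |c|) * (P n).real {ω | (n, Y n ω) ∉
      {p : κ × E | p ∈ R → |φ p.1 p.2 - c| < δ / 2}} < δ / 2 at hn
    set A := {ω | (n, Y n ω) ∉ {p : κ × E | p ∈ R → |φ p.1 p.2 - c| < δ / 2}} with hA
    have hAm : MeasurableSet A := (MeasurableSet.of_discrete
      (s := {y | (n, y) ∉ {p : κ × E | p ∈ R → |φ p.1 p.2 - c| < δ / 2}})).preimage (hYm n)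
    have hAint : Integrable (A.indicator fun _ => 1 + |c|) (P n) :=
      (integrable_const _).indicator hAm
    have hb : Integrable (fun ω => δ / 2 + A.indicator (fun _ => 1 + |c|) ω) (P n) :=
      (integrable_const _).add hAint
    rw [dist_zero_right]
    calc ‖∫ ω in B n, (φ n (Y n ω) - c) ∂P n‖
        ≤ ∫ ω in B n, (δ / 2 + A.indicator (fun _ => 1 + |c|) ω) ∂P n := by
          refine norm_integral_le_of_norm_le hb.integrableOn
            ((ae_restrict_iff' (hBm n)).2 (ae_of_all _ fun ω hω => ?_))
          rw [Real.norm_eq_abs]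
          by_cases hωA : ω ∈ A
          · rw [indicator_of_mem hωA]
            refine (abs_sub _ _).trans ?_
            rw [abs_of_nonneg (hφ0 _ _)]
            linarith [hφ1 n (Y n ω)]
          · rw [indicator_of_notMem hωA, add_zero]
            simp only [hA, mem_ofPred_eq, not_not] at hωA
            exact (hωA (hBR n ω hω)).le
      _ ≤ ∫ ω, (δ / 2 + A.indicator (fun _ => 1 + |c|) ω) ∂P n := by
          refine setIntegral_le_integral hb (ae_of_all _ fun ω => ?_)
          exact add_nonneg (by positivity) (indicator_nonneg (fun _ _ => by positivity) _)
      _ = δ / 2 + (1 + |c|) * (P n).real A := by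
          rw [integral_add (integrable_const _) hAint, integral_indicator_const _ hAm]
          simp [mul_comm]
      _ < δ := by linarith
  have hreal : Tendsto (fun n => ∫ ω in B n, φ n (Y n ω) ∂P n) l (𝓝 (c * β.toReal)) := by
    have := hdiff.add (hBr.const_mul c)
    rw [zero_add] at this
    refine this.congr fun n => ?_
    rw [integral_sub (hint n _) (integrable_const _)]
    simp [mul_comm]
  have hlim := ENNReal.tendsto_ofReal hreal
  rw [ENNReal.ofReal_mul hc, ENNReal.ofReal_toReal hβ] at hlim
  refine hlim.congr fun n => ?_
  exact ofReal_integral_eq_lintegral_ofReal (hint n _) (ae_of_all _ fun ω => hφ0 _ _)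

end InProbability

/-! ### Single transitions of the saturated system. -/

instance XState.instDiscreteMeasurableSpace : DiscreteMeasurableSpace XState := ⟨fun _ => trivial⟩

/-- The effect of an event on `D₁₂`, when both queues are nonempty, all agents are busy and pool 1
does not help class 2. -/
noncomputable def diffJump (r d : ℝ) : XEvent → ℝ
  | .arr1 => 1
  | .arr2 => -r
  | .srv11 | .srv21 | .abd1 => -1
  | .srv12 | .srv22 => if 0 < d then -1 else r
  | .abd2 => r

lemma abs_diffJump_le (r d : ℝ) (e : XEvent) : |diffJump r d e| ≤ 1 + |r| := by
  have := abs_nonneg r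
  cases e <;> simp only [diffJump] <;> (try split_ifs) <;>
    (try simp only [abs_neg, abs_one]) <;> linarith

/-- No agent idles and pool 1 does not help class 2. -/
def XSize.IsSaturated (N : XSize) (x : XState) : Prop :=
  x.z21 = 0 ∧ x.z11 = N.m1 ∧ x.z12 + x.z22 = N.m2

/-- Every agent who becomes free immediately takes a waiting customer: from queue 1 in pool 1, and
from the queue selected by the sign of `D₁₂` in pool 2. Positive rate matters only for saturation: a
completion of an absent service would, by truncated subtraction, add a customer to a full pool. -/
lemma XSize.IsSaturated.next {p : XRates} {N : XSize} {x : XState} (h : N.IsSaturated x)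
    (h1 : 0 < x.q1) (h2 : 0 < x.q2) (h11 : 0 < x.z11) (hD : ¬ 0 < diff21 p N x) (e : XEvent) :
    ((xMechanism p N).rate e x ≠ 0 → N.IsSaturated ((xMechanism p N).next e x)) ∧
      |(((xMechanism p N).next e x).q1 : ℝ) - x.q1| ≤ 1 ∧
      |(((xMechanism p N).next e x).q2 : ℝ) - x.q2| ≤ 1 ∧
      |(((xMechanism p N).next e x).z12 : ℝ) - x.z12| ≤ 1 ∧
      diff12 p N ((xMechanism p N).next e x) = diff12 p N x + diffJump p.r12 (diff12 p N x) e := by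
  have hc1 : ((x.q1 - 1 : ℕ) : ℝ) = x.q1 - 1 := by rw [Nat.cast_sub h1, Nat.cast_one]
  have hc2 : ((x.q2 - 1 : ℕ) : ℝ) = x.q2 - 1 := by rw [Nat.cast_sub h2, Nat.cast_one]
  have hc12 : |((x.z12 - 1 : ℕ) : ℝ) + 1 - x.z12| ≤ 1 ∧ |((x.z12 - 1 : ℕ) : ℝ) - x.z12| ≤ 1 := by
    cases x.z12 <;> simp
  obtain ⟨hz, hm, hm2⟩ := h
  have hr1 : ∀ y, route1 p N x y = { y with q1 := y.q1 - 1, z11 := y.z11 + 1 } := fun y => by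
    rw [route1, if_neg fun hc => hD hc.1, if_pos h1]
  have hr2 : ∀ y, 0 < diff12 p N x →
      route2 p N x y = { y with q1 := y.q1 - 1, z12 := y.z12 + 1 } := fun y hd => by
    rw [route2, if_pos ⟨hd, hz, h1⟩]
  have hr2' : ∀ y, ¬ 0 < diff12 p N x →
      route2 p N x y = { y with q2 := y.q2 - 1, z22 := y.z22 + 1 } := fun y hd => by
    rw [route2, if_neg fun hc => hd hc.1, if_pos h2]
  have hn1 : ¬ x.z11 + x.z21 < N.m1 := by omega
  have hn2 : ¬ x.z12 + x.z22 < N.m2 := by omega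
  have hz12 : p.mu12 * (x.z12 : ℝ) ≠ 0 → 0 < x.z12 := fun hne =>
    Nat.pos_of_ne_zero fun h0 => hne (by simp [h0])
  have hz22 : p.mu22 * (x.z22 : ℝ) ≠ 0 → 0 < x.z22 := fun hne =>
    Nat.pos_of_ne_zero fun h0 => hne (by simp [h0])
  by_cases hd : 0 < diff12 p N x
  -- Only the sign of `D₁₂` matters, so a numeral in its place lets `simp` decide the case.
  · have hdj : ∀ e, diffJump p.r12 (diff12 p N x) e = diffJump p.r12 1 e := fun e => by
      cases e <;> simp [diffJump, hd]
    rw [hdj]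
    refine ⟨?_, ?_⟩
    · cases e <;> simp only [xMechanism, hr1, hr2 _ hd, if_neg hn1, if_neg hn2,
        XSize.IsSaturated] <;> intro hr <;> (try have := hz12 hr) <;> (try have := hz22 hr) <;>
        simp at hr <;> omega
    · cases e <;> simp [xMechanism, hr1, hr2 _ hd, if_neg hn1, if_neg hn2, diff12, diffJump, hc1,
        hc2, hc12] <;> ring
  · have hdj : ∀ e, diffJump p.r12 (diff12 p N x) e = diffJump p.r12 0 e := fun e => by
      cases e <;> simp [diffJump, hd]
    rw [hdj]
    refine ⟨?_, ?_⟩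
    · cases e <;> simp only [xMechanism, hr1, hr2' _ hd, if_neg hn1, if_neg hn2,
        XSize.IsSaturated] <;> intro hr <;> (try have := hz12 hr) <;> (try have := hz22 hr) <;>
        simp at hr <;> omega
    · cases e <;> simp [xMechanism, hr1, hr2' _ hd, if_neg hn1, if_neg hn2, diff12, diffJump, hc1,
        hc2, hc12] <;> ring

/-! ### The asymptotic regime: stability under jumps, and limits of the rates. -/

/-- The regime in which the `n`-th system, in state `x`, is close to the fluid state `g`, with both
queues nonempty, all agents busy, and pool 1 not allowed to help class 2. -/
noncomputable def nearFluid (p : XRates) (N : ℕ+ → XSize) (g : FluidState) : Filter (ℕ+ × XState) :=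
  comap Prod.fst atTop ⊓ comap (fun s => (s.2.q1 : ℝ)) atTop ⊓ comap (fun s => (s.2.q2 : ℝ)) atTop ⊓
    comap (fun s => diff12 p (N s.1) s.2 + ((N s.1).k12 + (N s.1).k21)) atTop ⊓
    comap (fun s => (s.2.q1 : ℝ) / (s.1 : ℕ)) (𝓝 g.q1) ⊓
    comap (fun s => (s.2.q2 : ℝ) / (s.1 : ℕ)) (𝓝 g.q2) ⊓
    comap (fun s => (s.2.z12 : ℝ) / (s.1 : ℕ)) (𝓝 g.z12) ⊓
    𝓟 {s | (N s.1).IsSaturated s.2}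

section NearFluid

variable {p : XRates} {N : ℕ+ → XSize} {g : FluidState}

lemma tendsto_nearFluid_iff {α : Type*} {l : Filter α} {f : α → ℕ+ × XState} :
    Tendsto f l (nearFluid p N g) ↔ Tendsto (fun a => (f a).1) l atTop ∧
      Tendsto (fun a => ((f a).2.q1 : ℝ)) l atTop ∧ Tendsto (fun a => ((f a).2.q2 : ℝ)) l atTop ∧
      Tendsto (fun a => diff12 p (N (f a).1) (f a).2 + ((N (f a).1).k12 + (N (f a).1).k21)) l
        atTop ∧
      Tendsto (fun a => ((f a).2.q1 : ℝ) / ((f a).1 : ℕ)) l (𝓝 g.q1) ∧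
      Tendsto (fun a => ((f a).2.q2 : ℝ) / ((f a).1 : ℕ)) l (𝓝 g.q2) ∧
      Tendsto (fun a => ((f a).2.z12 : ℝ) / ((f a).1 : ℕ)) l (𝓝 g.z12) ∧
      ∀ᶠ a in l, (N (f a).1).IsSaturated (f a).2 := by
  simp only [nearFluid, tendsto_inf, tendsto_comap_iff, tendsto_principal, and_assoc,
    Function.comp_def, mem_ofPred_eq]

lemma nearFluid_spec : Tendsto (fun s : ℕ+ × XState => s.1) (nearFluid p N g) atTop ∧
      Tendsto (fun s : ℕ+ × XState => (s.2.q1 : ℝ)) (nearFluid p N g) atTop ∧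
      Tendsto (fun s : ℕ+ × XState => (s.2.q2 : ℝ)) (nearFluid p N g) atTop ∧
      Tendsto (fun s : ℕ+ × XState => diff12 p (N s.1) s.2 + ((N s.1).k12 + (N s.1).k21))
        (nearFluid p N g) atTop ∧
      Tendsto (fun s : ℕ+ × XState => (s.2.q1 : ℝ) / (s.1 : ℕ)) (nearFluid p N g) (𝓝 g.q1) ∧
      Tendsto (fun s : ℕ+ × XState => (s.2.q2 : ℝ) / (s.1 : ℕ)) (nearFluid p N g) (𝓝 g.q2) ∧
      Tendsto (fun s : ℕ+ × XState => (s.2.z12 : ℝ) / (s.1 : ℕ)) (nearFluid p N g) (𝓝 g.z12) ∧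
      ∀ᶠ s in nearFluid p N g, (N s.1).IsSaturated s.2 :=
  tendsto_nearFluid_iff.1 tendsto_id

lemma tendsto_pnat_cast_atTop : Tendsto (fun n : ℕ+ => ((n : ℕ) : ℝ)) atTop atTop :=
  tendsto_natCast_atTop_atTop.comp tendsto_PNat_val_atTop_atTop

/-- Along `nearFluid`, no class-2 customer is routed to pool 1. -/
lemma eventually_nearFluid_diff21 (hr : p.r21 ≤ p.r12) :
    ∀ᶠ s in nearFluid p N g, ¬ 0 < diff21 p (N s.1) s.2 := by
  obtain ⟨-, -, -, h, -⟩ := nearFluid_spec (p := p) (N := N) (g := g)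
  filter_upwards [h.eventually_ge_atTop 0] with s hs
  -- `D₁₂ + k₁₂ + k₂₁ = Q₁ + k₂₁ - r₁₂ Q₂`; since `r₂₁ ≤ r₁₂`, its nonnegativity forces `D₂₁ ≤ 0`.
  have : p.r21 * (s.2.q2 : ℝ) ≤ p.r12 * s.2.q2 := by gcongr
  simp only [diff12] at hs
  simp only [diff21, not_lt]
  linarith

lemma eventually_nearFluid_next {F : FluidSize} (hr : p.r21 ≤ p.r12) (hF : 0 < F.m1)
    (hm1 : Tendsto (fun n : ℕ+ => ((N n).m1 : ℝ) / (n : ℕ)) atTop (𝓝 F.m1)) :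
    ∀ᶠ s in nearFluid p N g, ∀ e,
      ((xMechanism p (N s.1)).rate e s.2 ≠ 0 →
        (N s.1).IsSaturated ((xMechanism p (N s.1)).next e s.2)) ∧
      |(((xMechanism p (N s.1)).next e s.2).q1 : ℝ) - s.2.q1| ≤ 1 ∧
      |(((xMechanism p (N s.1)).next e s.2).q2 : ℝ) - s.2.q2| ≤ 1 ∧
      |(((xMechanism p (N s.1)).next e s.2).z12 : ℝ) - s.2.z12| ≤ 1 ∧
      diff12 p (N s.1) ((xMechanism p (N s.1)).next e s.2) =
        diff12 p (N s.1) s.2 + diffJump p.r12 (diff12 p (N s.1) s.2) e := by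
  obtain ⟨hn, h1, h2, -, -, -, -, hsat⟩ := nearFluid_spec (p := p) (N := N) (g := g)
  filter_upwards [hsat, h1.eventually_gt_atTop 0, h2.eventually_gt_atTop 0,
    eventually_nearFluid_diff21 hr, (hm1.comp hn).eventually (lt_mem_nhds hF)]
    with s hs hs1 hs2 hD hm e
  refine hs.next (by exact_mod_cast hs1) (by exact_mod_cast hs2) ?_ hD e
  rw [hs.2.1]
  by_contra hcon
  simp [Nat.eq_zero_of_not_pos hcon] at hm

lemma tendsto_div_of_abs_sub_le_one {α : Type*} {l : Filter α} {n : α → ℕ+} {u v : α → ℝ} {a : ℝ}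
    (hn : Tendsto n l atTop) (hu : Tendsto (fun x => u x / (n x : ℕ)) l (𝓝 a))
    (h : ∀ᶠ x in l, |v x - u x| ≤ 1) : Tendsto (fun x => v x / (n x : ℕ)) l (𝓝 a) := by
  have h0 : Tendsto (fun x => (v x - u x) / (n x : ℕ)) l (𝓝 0) := by
    have hinv : Tendsto (fun x => ((n x : ℕ) : ℝ)⁻¹) l (𝓝 0) :=
      (tendsto_pnat_cast_atTop.comp hn).inv_tendsto_atTop
    refine squeeze_zero_norm' (h.mono fun x hx => ?_) hinv
    have : (0 : ℝ) < (n x : ℕ) := by exact_mod_cast (n x).pos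
    rw [norm_div, Real.norm_eq_abs, Real.norm_eq_abs, abs_of_pos this, ← one_div]
    gcongr
  have := h0.add hu
  rw [zero_add] at this
  refine this.congr fun x => ?_
  ring

/-- Bounded changes affect neither divergence to infinity nor limits after division by `n`. Only the
persistence of saturation requires the event to have nonzero rate. -/
lemma tendsto_nearFluid_next {F : FluidSize} (hr : p.r21 ≤ p.r12) (hF : 0 < F.m1)
    (hm1 : Tendsto (fun n : ℕ+ => ((N n).m1 : ℝ) / (n : ℕ)) atTop (𝓝 F.m1)) (e : XEvent) :
    Tendsto (fun s : ℕ+ × XState => (s.1, (xMechanism p (N s.1)).next e s.2))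
      (nearFluid p N g ⊓ 𝓟 {s | (xMechanism p (N s.1)).rate e s.2 ≠ 0}) (nearFluid p N g) := by
  have hnext := eventually_nearFluid_next (g := g) hr hF hm1
  obtain ⟨hn, h1, h2, hk, hq1, hq2, hz, hsat⟩ := nearFluid_spec (p := p) (N := N) (g := g)
  have hle : nearFluid p N g ⊓ 𝓟 {s | (xMechanism p (N s.1)).rate e s.2 ≠ 0} ≤ nearFluid p N g :=
    inf_le_left
  refine tendsto_nearFluid_iff.2 ⟨hn.mono_left hle, ?_, ?_, ?_, ?_, ?_, ?_, ?_⟩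
  · refine (tendsto_atTop_mono' _ (hnext.mono fun s hs => ?_)
      (tendsto_atTop_add_const_right _ (-1) h1)).mono_left hle
    linarith [(abs_le.1 (hs e).2.1).1]
  · refine (tendsto_atTop_mono' _ (hnext.mono fun s hs => ?_)
      (tendsto_atTop_add_const_right _ (-1) h2)).mono_left hle
    linarith [(abs_le.1 (hs e).2.2.1).1]
  · refine (tendsto_atTop_mono' _ (hnext.mono fun s hs => ?_)
      (tendsto_atTop_add_const_right _ (-(1 + |p.r12|)) hk)).mono_left hle
    have := (abs_le.1 (abs_diffJump_le p.r12 (diff12 p (N s.1) s.2) e)).1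
    simp only [(hs e).2.2.2.2]
    linarith
  · exact (tendsto_div_of_abs_sub_le_one hn hq1 (hnext.mono fun s hs => (hs e).2.1)).mono_left hle
  · exact (tendsto_div_of_abs_sub_le_one hn hq2
      (hnext.mono fun s hs => (hs e).2.2.1)).mono_left hle
  · exact (tendsto_div_of_abs_sub_le_one hn hz
      (hnext.mono fun s hs => (hs e).2.2.2.1)).mono_left hle
  · rw [eventually_inf_principal]
    exact hnext.mono fun s hs hr => (hs e).1 hr

lemma eventually_nearFluid_next_mem {F : FluidSize} (hr : p.r21 ≤ p.r12) (hF : 0 < F.m1)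
    (hm1 : Tendsto (fun n : ℕ+ => ((N n).m1 : ℝ) / (n : ℕ)) atTop (𝓝 F.m1))
    {S : Set (ℕ+ × XState)} (hS : S ∈ nearFluid p N g) :
    ∀ᶠ s in nearFluid p N g, ∀ e, (xMechanism p (N s.1)).rate e s.2 ≠ 0 →
      (s.1, (xMechanism p (N s.1)).next e s.2) ∈ S := by
  rw [eventually_all]
  intro e
  have := tendsto_nearFluid_next (g := g) hr hF hm1 e hS
  exact eventually_inf_principal.1 this

/-- The limits of the rates of the CTMC, divided by `n`. -/
def fluidRate (p : XRates) (F : FluidSize) (g : FluidState) : XEvent → ℝ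
  | .arr1 => F.lam1
  | .arr2 => F.lam2
  | .srv11 => p.mu11 * F.m1
  | .srv12 => p.mu12 * g.z12
  | .srv21 => 0
  | .srv22 => p.mu22 * (F.m2 - g.z12)
  | .abd1 => p.theta1 * g.q1
  | .abd2 => p.theta2 * g.q2

/-- Saturation expresses the remaining coordinates through the controlled ones: `Z₁₁ = m₁`, `Z₂₁ =
0` and `Z₂₂ = m₂ - Z₁₂`. -/
lemma tendsto_nearFluid_rate {F : FluidSize}
    (hlam1 : Tendsto (fun n : ℕ+ => (N n).lam1 / (n : ℕ)) atTop (𝓝 F.lam1))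
    (hlam2 : Tendsto (fun n : ℕ+ => (N n).lam2 / (n : ℕ)) atTop (𝓝 F.lam2))
    (hm1 : Tendsto (fun n : ℕ+ => ((N n).m1 : ℝ) / (n : ℕ)) atTop (𝓝 F.m1))
    (hm2 : Tendsto (fun n : ℕ+ => ((N n).m2 : ℝ) / (n : ℕ)) atTop (𝓝 F.m2)) (e : XEvent) :
    Tendsto (fun s : ℕ+ × XState => (xMechanism p (N s.1)).rate e s.2 / (s.1 : ℕ))
      (nearFluid p N g) (𝓝 (fluidRate p F g e)) := by
  obtain ⟨hn, h1, h2, hk, hq1, hq2, hz, hsat⟩ := nearFluid_spec (p := p) (N := N) (g := g)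
  cases e <;> simp only [xMechanism, fluidRate, mul_div_assoc]
  · exact hlam1.comp hn
  · exact hlam2.comp hn
  · refine ((hm1.comp hn).congr' (hsat.mono fun s hs => ?_)).const_mul _
    simp [hs.2.1]
  · exact hz.const_mul _
  · refine tendsto_const_nhds.congr' (hsat.mono fun s hs => ?_)
    simp [hs.1]
  · refine (((hm2.comp hn).sub hz).congr' (hsat.mono fun s hs => ?_)).const_mul _
    simp only [Function.comp_apply, ← hs.2.2]
    push_cast
    ring
  · exact hq1.const_mul _
  · exact hq2.const_mul _

end NearFluid

/-! ### Convergence of cell probabilities by induction over jumps. -/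

/-- Prescribed values of `I 0, …, I k` and `U 0, …, U (k - 1)`. -/
def cellEvent {Ω : Type*} (I : ℕ → Ω → ℤ) (U : ℕ → Ω → ℕ) (j : ℕ → ℤ) (l : ℕ → ℕ) : ℕ → Set Ω
  | 0 => {ω | I 0 ω = j 0}
  | k + 1 => cellEvent I U j l k ∩ {ω | U k ω = l k} ∩ {ω | I (k + 1) ω = j (k + 1)}

lemma mem_cellEvent {Ω : Type*} {I : ℕ → Ω → ℤ} {U : ℕ → Ω → ℕ} {j : ℕ → ℤ} {l : ℕ → ℕ} {k : ℕ}
    {ω : Ω} : ω ∈ cellEvent I U j l k ↔ (∀ i < k + 1, I i ω = j i) ∧ ∀ i < k, U i ω = l i := by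
  induction k with
  | zero => simp [cellEvent]
  | succ k ih =>
    rw [cellEvent, mem_inter_iff, mem_inter_iff, ih, Nat.forall_lt_succ_right (n := k + 1),
      Nat.forall_lt_succ_right (n := k) (p := fun i => U i ω = l i)]
    simp only [mem_ofPred_eq]
    tauto

lemma measurableSet_cellEvent {Ω : Type*} {mΩ : MeasurableSpace Ω} {I : ℕ → Ω → ℤ}
    {U : ℕ → Ω → ℕ} (j : ℕ → ℤ) (l : ℕ → ℕ) {k : ℕ} (hI : ∀ i ≤ k, Measurable (I i))
    (hU : ∀ i < k, Measurable (U i)) : MeasurableSet (cellEvent I U j l k) := by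
  induction k with
  | zero => exact hI 0 le_rfl (measurableSet_singleton (j 0))
  | succ k ih =>
    exact ((ih (fun i hi => hI i (by omega)) fun i hi => hU i (by omega)).inter
      (hU k (by omega) (measurableSet_singleton (l k)))).inter
      (hI (k + 1) le_rfl (measurableSet_singleton (j (k + 1))))

lemma setOf_cellIndex_eq {Ω : Type*} {I : ℕ → Ω → ℤ} {T : ℕ → Ω → ℝ} {m : ℕ}
    (c : (Fin (m + 1) → ℤ) × (Fin m → ℕ)) :
    {ω | cellIndex m (fun k => I k ω) (fun k => T k ω) = c} =
      cellEvent I (fun k ω => ⌈2 ^ m * T k ω⌉₊)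
        (fun k => if h : k < m + 1 then c.1 ⟨k, h⟩ else 0)
        (fun k => if h : k < m then c.2 ⟨k, h⟩ else 0) m := by
  ext ω
  rw [mem_cellEvent]
  simp only [mem_ofPred_eq, cellIndex, Prod.ext_iff, funext_iff, Fin.forall_iff]
  refine and_congr (forall₂_congr fun k hk => ?_) (forall₂_congr fun k hk => ?_) <;> simp [hk]

/-- Rounding up gives the interval `(q / K, (q + 1) / K]`, hence a difference of two tail events `{s
< T}`, the events for which the jump law has a formula. -/
lemma measure_inter_ceil_eq_sub {Ω : Type*} [MeasurableSpace Ω] {P : Measure Ω}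
    [IsFiniteMeasure P] {A C : Set Ω} {T : Ω → ℝ} (hA : MeasurableSet A) (hC : MeasurableSet C)
    (hT : Measurable T) {K : ℝ} (hK : 0 < K) (q : ℕ) :
    P (A ∩ {ω | ⌈K * T ω⌉₊ = q + 1} ∩ C) =
      P (A ∩ {ω | q / K < T ω} ∩ C) - P (A ∩ {ω | (q + 1 : ℕ) / K < T ω} ∩ C) := by
  rw [← measure_sdiff]
  · congr 1
    ext ω
    simp only [mem_inter_iff, mem_ofPred_eq, Set.mem_sdiff, Nat.ceil_eq_iff (Nat.succ_ne_zero q),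
      Nat.succ_sub_one, div_lt_iff₀' hK, not_and, Nat.succ_eq_add_one, ← not_lt]
    tauto
  · rintro ω ⟨⟨h1, h2⟩, h3⟩
    refine ⟨⟨h1, lt_of_le_of_lt (b := ((q + 1 : ℕ) : ℝ) / K) ?_ h2⟩, h3⟩
    gcongr
    simp
  · exact ((hA.inter (measurableSet_lt measurable_const hT)).inter hC).nullMeasurableSet
  · exact measure_ne_top _ _

/-- The multiples of `1 / b`. -/
def gridPoints (b : ℝ) : Set ℝ := range fun i : ℤ => (i : ℝ) / b

lemma floor_div_of_mem_gridPoints {b d : ℝ} (hb : 0 < b) (h : d ∈ gridPoints b) :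
    (⌊b * d⌋ : ℝ) / b = d := by
  obtain ⟨i, rfl⟩ := h
  simp only
  rw [mul_div_cancel₀ _ hb.ne', Int.floor_intCast]

lemma floor_eq_iff_of_mem_gridPoints {b d : ℝ} (hb : 0 < b) (h : d ∈ gridPoints b) (j : ℤ) :
    ⌊b * d⌋ = j ↔ d = j / b := by
  constructor
  · rintro rfl
    exact (floor_div_of_mem_gridPoints hb h).symm
  · rintro rfl
    rw [mul_div_cancel₀ _ hb.ne', Int.floor_intCast]

/-- If a function of a pure-jump process on a fast time scale asymptotically jumps as a pure-jump
process with values in a grid does, then the joint laws of its first values and holding times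
converge. -/
lemma tendsto_measure_cellEvent {κ E ι ι' Ω' : Type*} [Fintype ι] [Fintype ι']
    [MeasurableSpace E] [DiscreteMeasurableSpace E] {l : Filter κ}
    {Ω : κ → Type*} [∀ n, MeasurableSpace (Ω n)] [MeasurableSpace Ω']
    {P : ∀ n, Measure (Ω n)} [∀ n, IsProbabilityMeasure (P n)]
    {P' : Measure Ω'} [IsProbabilityMeasure P']
    {G : κ → JumpMechanism E ι} {Y : ∀ n, ℕ → Ω n → E} {T : ∀ n, ℕ → Ω n → ℝ}
    (hG : ∀ n e x, 0 ≤ (G n).rate e x) (hlaw : ∀ n, HasJumpLaw (P n) (G n) (Y n) (T n))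
    (hYm : ∀ n k, Measurable (Y n k)) (hTm : ∀ n k, Measurable (T n k))
    (hT : ∀ n, ∀ᵐ ω ∂P n, ∀ k, 0 < T n k ω)
    {H : JumpMechanism ℝ ι'} {Y' T' : ℕ → Ω' → ℝ}
    (hH : ∀ e x, 0 ≤ H.rate e x) (hlaw' : HasJumpLaw P' H Y' T')
    (hYm' : ∀ k, Measurable (Y' k)) (hTm' : ∀ k, Measurable (T' k))
    (hT' : ∀ᵐ ω ∂P', ∀ k, 0 < T' k ω)
    {f : κ → E → ℝ} {b : ℝ} (hb : 0 < b) (hf : ∀ n x, f n x ∈ gridPoints b)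
    (hY' : ∀ᵐ ω ∂P', ∀ k, Y' k ω ∈ gridPoints b) {α : κ → ℝ} (hα : ∀ n, 0 < α n)
    {𝓖 : Filter (κ × E)} (hY : ∀ k, probFilter l P (fun n => Y n k) ≤ 𝓖)
    (hstep : ∀ (d s : ℝ), 0 ≤ s → ∀ C : Set ℝ,
      Tendsto (fun q : κ × E => (G q.1).stepProb (s / α q.1) (f q.1 ⁻¹' C) q.2)
        (𝓖 ⊓ 𝓟 {q | f q.1 q.2 = d}) (𝓝 (H.stepProb s C d)))
    (h0 : ∀ j : ℤ, Tendsto (fun n => P n {ω | ⌊b * f n (Y n 0 ω)⌋ = j}) l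
      (𝓝 (P' {ω | ⌊b * Y' 0 ω⌋ = j})))
    {K : ℝ} (hK : 0 < K) (j : ℕ → ℤ) (u : ℕ → ℕ) (k : ℕ) :
    Tendsto (fun n => P n (cellEvent (fun i ω => ⌊b * f n (Y n i ω)⌋)
      (fun i ω => ⌈K * (α n * T n i ω)⌉₊) j u k)) l
      (𝓝 (P' (cellEvent (fun i ω => ⌊b * Y' i ω⌋) (fun i ω => ⌈K * T' i ω⌉₊) j u k))) := by
  have hfloor : Measurable fun d : ℝ => ⌊b * d⌋ := Int.measurable_floor.comp (measurable_const_mul b)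
  have hfm : ∀ n, Measurable fun x => ⌊b * f n x⌋ := fun n => Measurable.of_discrete
  have hceil : ∀ c d : ℝ, Measurable fun t : ℝ => ⌈c * (d * t)⌉₊ := fun c d =>
    Nat.measurable_ceil.comp ((measurable_const_mul c).comp (measurable_const_mul d))
  have hceil' : ∀ c : ℝ, Measurable fun t : ℝ => ⌈c * t⌉₊ := fun c =>
    Nat.measurable_ceil.comp (measurable_const_mul c)
  induction k with
  | zero => exact h0 (j 0)
  | succ k ih =>
    have hB : ∀ n, MeasurableSet[jumpHistory (Y n) (T n) k] (cellEvent
        (fun i ω => ⌊b * f n (Y n i ω)⌋) (fun i ω => ⌈K * (α n * T n i ω)⌉₊) j u k) := fun n =>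
      measurableSet_cellEvent j u
        (fun i hi => (hfm n).comp (measurable_jumpHistory_state hi))
        (fun i hi => (hceil _ _).comp (measurable_jumpHistory_time hi))
    have hBm : ∀ n, MeasurableSet (cellEvent
        (fun i ω => ⌊b * f n (Y n i ω)⌋) (fun i ω => ⌈K * (α n * T n i ω)⌉₊) j u k) := fun n =>
      measurableSet_cellEvent j u (fun i _ => (hfm n).comp (hYm n i))
        (fun i _ => (hceil _ _).comp (hTm n i))
    have hB' : MeasurableSet[jumpHistory Y' T' k] (cellEvent
        (fun i ω => ⌊b * Y' i ω⌋) (fun i ω => ⌈K * T' i ω⌉₊) j u k) :=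
      measurableSet_cellEvent j u
        (fun i hi => hfloor.comp (measurable_jumpHistory_state hi))
        (fun i hi => (hceil' _).comp (measurable_jumpHistory_time hi))
    have hBm' : MeasurableSet (cellEvent
        (fun i ω => ⌊b * Y' i ω⌋) (fun i ω => ⌈K * T' i ω⌉₊) j u k) :=
      measurableSet_cellEvent j u (fun i _ => hfloor.comp (hYm' i))
        (fun i _ => (hceil' _).comp (hTm' i))
    -- The inductive step for tails of the holding time. The earlier part of the cell belongs to the
    -- history and fixes the current value `j k / b`, so the one-step probability tends to a
    -- constant, which factors out of the integral.
    have half : ∀ s : ℝ, 0 ≤ s → Tendsto (fun n => P n (cellEvent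
        (fun i ω => ⌊b * f n (Y n i ω)⌋) (fun i ω => ⌈K * (α n * T n i ω)⌉₊) j u k ∩
          {ω | s / α n < T n k ω} ∩ {ω | ⌊b * f n (Y n (k + 1) ω)⌋ = j (k + 1)})) l
        (𝓝 (P' (cellEvent (fun i ω => ⌊b * Y' i ω⌋) (fun i ω => ⌈K * T' i ω⌉₊) j u k ∩
          {ω | s < T' k ω} ∩ {ω | ⌊b * Y' (k + 1) ω⌋ = j (k + 1)}))) := by
      intro s hs
      set C : Set ℝ := {d | ⌊b * d⌋ = j (k + 1)} with hC
      have hCm : MeasurableSet C := hfloor (measurableSet_singleton (j (k + 1)))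
      have e1 := fun n => (hlaw n).measure_eq_lintegral_stepProb (hB n)
        (div_nonneg hs (hα n).le) (MeasurableSet.of_discrete (s := f n ⁻¹' C)) (hG n)
      have e2 := hlaw'.measure_eq_lintegral_stepProb hB' hs hCm hH
      have e3 : ∫⁻ ω in cellEvent (fun i ω => ⌊b * Y' i ω⌋) (fun i ω => ⌈K * T' i ω⌉₊) j u k,
          ENNReal.ofReal (H.stepProb s C (Y' k ω)) ∂P' =
          ENNReal.ofReal (H.stepProb s C (j k / b)) *
            P' (cellEvent (fun i ω => ⌊b * Y' i ω⌋) (fun i ω => ⌈K * T' i ω⌉₊) j u k) := by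
        rw [← setLIntegral_const]
        refine setLIntegral_congr_fun_ae hBm' ?_
        filter_upwards [hY'] with ω hω hmem
        rw [(floor_eq_iff_of_mem_gridPoints hb (hω k) (j k)).1
          ((mem_cellEvent.1 hmem).1 k (Nat.lt_succ_self k))]
      have e4 := tendsto_setLIntegral_of_probFilter_le (fun n => hYm n k) (hY k)
        (φ := fun n x => (G n).stepProb (s / α n) (f n ⁻¹' C) x)
        (fun n x => JumpMechanism.stepProb_nonneg (fun e => hG n e x) _ _)
        (fun n x => JumpMechanism.stepProb_le_one (fun e => hG n e x)
          (div_nonneg hs (hα n).le) _)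
        (JumpMechanism.stepProb_nonneg (fun e => hH e _) s C) (hstep (j k / b) s hs C) hBm
        (fun n ω hω => (floor_eq_iff_of_mem_gridPoints hb (hf n _) (j k)).1
          ((mem_cellEvent.1 hω).1 k (Nat.lt_succ_self k))) (measure_ne_top _ _) ih
      rw [← e3, ← e2] at e4
      exact e4.congr fun n => (e1 n).symm
    simp only [cellEvent]
    -- Rounded value `0` means a nonpositive holding time, a null event on both sides. A positive
    -- value is a difference of two tails.
    cases hu : u k with
    | zero =>
      have z : ∀ n, P n (cellEvent (fun i ω => ⌊b * f n (Y n i ω)⌋)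
          (fun i ω => ⌈K * (α n * T n i ω)⌉₊) j u k ∩ {ω | ⌈K * (α n * T n k ω)⌉₊ = 0} ∩
          {ω | ⌊b * f n (Y n (k + 1) ω)⌋ = j (k + 1)}) = 0 := fun n => by
        rw [measure_eq_zero_iff_ae_notMem]
        filter_upwards [hT n] with ω hω hmem
        exact absurd (mul_pos hK (mul_pos (hα n) (hω k))) (not_lt.2 (Nat.ceil_eq_zero.1 hmem.1.2))
      have z' : P' (cellEvent (fun i ω => ⌊b * Y' i ω⌋) (fun i ω => ⌈K * T' i ω⌉₊) j u k ∩
          {ω | ⌈K * T' k ω⌉₊ = 0} ∩ {ω | ⌊b * Y' (k + 1) ω⌋ = j (k + 1)}) = 0 := by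
        rw [measure_eq_zero_iff_ae_notMem]
        filter_upwards [hT'] with ω hω hmem
        exact absurd (mul_pos hK (hω k)) (not_lt.2 (Nat.ceil_eq_zero.1 hmem.1.2))
      simp only [z, z']
      exact tendsto_const_nhds
    | succ q =>
      have d' := measure_inter_ceil_eq_sub (P := P') hBm'
        ((hfloor.comp (hYm' (k + 1))) (measurableSet_singleton (j (k + 1)))) (hTm' k) hK q
      have d := fun n => measure_inter_ceil_eq_sub (P := P n) (hBm n)
        (((hfm n).comp (hYm n (k + 1))) (measurableSet_singleton (j (k + 1)))) (hTm n k)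
        (mul_pos hK (hα n)) q
      have lim := ENNReal.Tendsto.sub (half (q / K) (by positivity))
        (half ((q + 1 : ℕ) / K) (by positivity)) (Or.inl (measure_ne_top _ _))
      simp only [div_div] at lim
      have lim' := lim.congr fun n => show _ = P n (cellEvent (fun i ω => ⌊b * f n (Y n i ω)⌋)
          (fun i ω => ⌈K * (α n * T n i ω)⌉₊) j u k ∩ {ω | ⌈K * (α n * T n k ω)⌉₊ = q + 1} ∩
          {ω | ⌊b * f n (Y n (k + 1) ω)⌋ = j (k + 1)}) from by
        have := d n
        simp only [mul_assoc] at this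
        exact this.symm
      change Tendsto _ l (𝓝 (P' (cellEvent (fun i ω => ⌊b * Y' i ω⌋) (fun i ω => ⌈K * T' i ω⌉₊) j u k ∩
        {ω | ⌈K * T' k ω⌉₊ = q + 1} ∩ (fun d => ⌊b * d⌋) ∘ Y' (k + 1) ⁻¹' {j (k + 1)})))
      rw [d']
      exact lim'

lemma isClosed_gridPoints {b : ℝ} (hb : 0 < b) : IsClosed (gridPoints b) := by
  have : gridPoints b = (fun d => b * d) ⁻¹' range ((↑) : ℤ → ℝ) := by
    ext d
    simp only [gridPoints, mem_range, mem_preimage]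
    refine exists_congr fun i => ?_
    rw [div_eq_iff hb.ne', mul_comm]
  rw [this]
  exact Int.isClosedEmbedding_coe_real.isClosed_range.preimage (continuous_const_mul b)

/-- The radius is half the grid spacing: the ball isolates one grid point and its boundary meets
none. Point masses of grid-valued variables thus become masses of continuity sets. -/
lemma mem_ball_iff_of_mem_gridPoints {b d : ℝ} (hb : 0 < b) (h : d ∈ gridPoints b) (j : ℤ) :
    d ∈ Metric.ball ((j : ℝ) / b) (1 / (2 * b)) ↔ d = j / b := by
  constructor
  · obtain ⟨i, rfl⟩ := h
    intro hd
    rw [Metric.mem_ball, Real.dist_eq, ← sub_div, abs_div, abs_of_pos hb, div_lt_iff₀ hb] at hd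
    have h2 : 1 / (2 * b) * b = 1 / 2 := by field_simp
    rw [h2, abs_lt] at hd
    have h3 : i = j := by
      have h4 : i < j + 1 := by exact_mod_cast (show (i : ℝ) < j + 1 by linarith [hd.2])
      have h5 : j < i + 1 := by exact_mod_cast (show (j : ℝ) < i + 1 by linarith [hd.1])
      omega
    rw [h3]
  · rintro rfl
    exact Metric.mem_ball_self (by positivity)

lemma notMem_sphere_of_mem_gridPoints {b d : ℝ} (hb : 0 < b) (h : d ∈ gridPoints b) (j : ℤ) :
    d ∉ Metric.sphere ((j : ℝ) / b) (1 / (2 * b)) := by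
  obtain ⟨i, rfl⟩ := h
  intro hd
  rw [Metric.mem_sphere, Real.dist_eq, ← sub_div, abs_div, abs_of_pos hb, div_eq_iff hb.ne'] at hd
  have h2 : 1 / (2 * b) * b = 1 / 2 := by field_simp
  rw [h2] at hd
  -- A point of the sphere would be half a spacing away from a grid point, which parity excludes.
  have h3 : 2 * |i - j| = 1 := by
    have : (2 * |(i : ℝ) - j| : ℝ) = 1 := by rw [hd]; norm_num
    exact_mod_cast this
  omega

/-! ### Consequences of convergence in distribution. -/

section Distribution

variable {κ E Ω' : Type*} {l : Filter κ} {Ω : κ → Type*} [∀ n, MeasurableSpace (Ω n)]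
  [MeasurableSpace Ω'] {P : ∀ n, Measure (Ω n)} [∀ n, IsProbabilityMeasure (P n)]
  {P' : Measure Ω'} [IsProbabilityMeasure P']

lemma tendsto_one_of_one_le_liminf {a : κ → ℝ≥0∞} (ha : ∀ n, a n ≤ 1) (h : 1 ≤ liminf a l) :
    Tendsto a l (𝓝 1) := by
  rcases l.eq_or_neBot with rfl | hl
  · exact tendsto_bot
  exact tendsto_of_le_liminf_of_limsup_le h
    (limsup_le_of_le (by isBoundedDefault) (Eventually.of_forall ha))

lemma mem_probFilter_of_tendsto_one [MeasurableSpace E] [DiscreteMeasurableSpace E]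
    {Y : ∀ n, Ω n → E} (hYm : ∀ n, Measurable (Y n)) {S : Set (κ × E)}
    (h : Tendsto (fun n => P n {ω | (n, Y n ω) ∈ S}) l (𝓝 1)) : S ∈ probFilter l P Y := by
  rw [mem_probFilter]
  have h1 : Tendsto (fun n => 1 - P n {ω | (n, Y n ω) ∈ S}) l (𝓝 0) := by
    simpa using ENNReal.Tendsto.sub tendsto_const_nhds h (Or.inl ENNReal.one_ne_top)
  refine h1.congr fun n => ?_
  have hm : MeasurableSet {ω | (n, Y n ω) ∈ S} :=
    (MeasurableSet.of_discrete (s := {y | (n, y) ∈ S})).preimage (hYm n)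
  exact (prob_compl_eq_one_sub hm).symm

variable [TopologicalSpace E] [MeasurableSpace E] [OpensMeasurableSpace E] [HasOuterApproxClosed E]
  {Z : ∀ n, Ω n → E} {Z' : Ω' → E}

lemma MeasureTheory.TendstoInDistribution.measure_isOpen_le_liminf
    (h : TendstoInDistribution Z l Z' P P')
    {U : Set E} (hU : IsOpen U) : P' {ω | Z' ω ∈ U} ≤ liminf (fun n => P n {ω | Z n ω ∈ U}) l := by
  have := ProbabilityMeasure.le_liminf_measure_open_of_tendsto h.tendsto hU
  simp only [ProbabilityMeasure.coe_mk,
    Measure.map_apply_of_aemeasurable h.aemeasurable_limit hU.measurableSet,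
    fun n => Measure.map_apply_of_aemeasurable (h.forall_aemeasurable n) hU.measurableSet] at this
  exact this

lemma MeasureTheory.TendstoInDistribution.ae_mem_of_isClosed [l.NeBot]
    (h : TendstoInDistribution Z l Z' P P')
    {A : Set E} (hA : IsClosed A) (hZ : ∀ n ω, Z n ω ∈ A) : ∀ᵐ ω ∂P', Z' ω ∈ A := by
  have := h.measure_isOpen_le_liminf hA.isOpen_compl
  simp only [mem_compl_iff, hZ, not_true_eq_false, ofPred_false, measure_empty, liminf_const,
    nonpos_iff_eq_zero] at this
  rw [ae_iff]
  exact this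

lemma MeasureTheory.TendstoInDistribution.tendsto_measure_of_null_frontier
    (h : TendstoInDistribution Z l Z' P P') {U : Set E} (hU : MeasurableSet U)
    (hfr : P' {ω | Z' ω ∈ frontier U} = 0) :
    Tendsto (fun n => P n {ω | Z n ω ∈ U}) l (𝓝 (P' {ω | Z' ω ∈ U})) := by
  have := ProbabilityMeasure.tendsto_measure_of_null_frontier_of_tendsto' (E := U) h.tendsto (by
    rw [ProbabilityMeasure.coe_mk, Measure.map_apply_of_aemeasurable h.aemeasurable_limit
      isClosed_frontier.measurableSet]
    exact hfr)
  simp only [ProbabilityMeasure.coe_mk,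
    Measure.map_apply_of_aemeasurable h.aemeasurable_limit hU,
    fun n => Measure.map_apply_of_aemeasurable (h.forall_aemeasurable n) hU] at this
  exact this

lemma MeasureTheory.TendstoInDistribution.tendsto_measure_mem_nhds {c : E}
    (h : TendstoInDistribution Z l (fun _ => c) P P') {V : Set E} (hV : V ∈ 𝓝 c) :
    Tendsto (fun n => P n {ω | Z n ω ∈ V}) l (𝓝 1) := by
  obtain ⟨U, hUV, hU, hc⟩ := mem_nhds_iff.1 hV
  refine tendsto_one_of_one_le_liminf (fun n => prob_le_one) ?_
  have := h.measure_isOpen_le_liminf hU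
  simp only [hc, ofPred_true, measure_univ] at this
  exact this.trans (liminf_le_liminf (Eventually.of_forall fun n =>
    measure_mono fun ω hω => hUV hω))

/-- A tight sequence shifted to infinity tends to infinity in probability. -/
lemma MeasureTheory.TendstoInDistribution.tendsto_measure_le_add {Z : ∀ n, Ω n → ℝ} {Z' : Ω' → ℝ}
    (h : TendstoInDistribution Z l Z' P P') {k : κ → ℝ} (hk : Tendsto k l atTop) (B : ℝ) :
    Tendsto (fun n => P n {ω | B ≤ Z n ω + k n}) l (𝓝 1) := by
  refine tendsto_one_of_one_le_liminf (fun n => prob_le_one) ?_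
  have hmono : Monotone fun M : ℕ => {ω | Z' ω ∈ Ioi (-(M : ℝ))} := fun M M' hM ω hω => by
    have : (M : ℝ) ≤ M' := by exact_mod_cast hM
    simp only [mem_ofPred_eq, mem_Ioi] at hω ⊢
    linarith
  have huniv : ⋃ M : ℕ, {ω | Z' ω ∈ Ioi (-(M : ℝ))} = univ := by
    refine eq_univ_of_forall fun ω => mem_iUnion.2 ?_
    obtain ⟨M, hM⟩ := exists_nat_gt (-Z' ω)
    exact ⟨M, by simp only [mem_ofPred_eq, mem_Ioi]; linarith⟩
  rw [← measure_univ (μ := P'), ← huniv, hmono.measure_iUnion]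
  refine iSup_le fun M => (h.measure_isOpen_le_liminf isOpen_Ioi).trans
    (liminf_le_liminf ?_)
  filter_upwards [hk.eventually_ge_atTop (B + M)] with n hn
  refine measure_mono fun ω hω => ?_
  simp only [mem_ofPred_eq, mem_Ioi] at hω ⊢
  linarith

end Distribution

/-! ### One-step law of the queue difference in the limit. -/

section QueueDifference

variable {p : XRates} {N : ℕ+ → XSize} {F : FluidSize} {g : FluidState}

/-- The lumping identity. Events with the same effect on `D₁₂` are merged; the pool-2 completions
count as `-1` above zero and as `+r` otherwise, which is the difference between `ratePlus` and
`rateMinus`. The test function `1` gives total rates, and indicators give jump probabilities. -/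
lemma sum_fluidRate_mul (d : ℝ) (f : ℝ → ℝ) :
    ∑ e, fluidRate p F g e * f (d + diffJump p.r12 d e) =
      ∑ e, (ftspMechanism p F g).rate e d * f ((ftspMechanism p F g).next e d) := by
  have h1 : (Finset.univ : Finset XEvent) =
      {.arr1, .arr2, .srv11, .srv12, .srv21, .srv22, .abd1, .abd2} := rfl
  have h2 : (Finset.univ : Finset FTSPEvent) = {.upOne, .upR, .downOne, .downR} := rfl
  rw [h1, h2]
  by_cases hd : 0 < d
  · simp [fluidRate, diffJump, ftspMechanism, hd, ratePlus, ← sub_eq_add_neg]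
    ring
  · simp [fluidRate, diffJump, ftspMechanism, hd, rateMinus, ← sub_eq_add_neg]
    ring

lemma sum_fluidRate (d : ℝ) : ∑ e, fluidRate p F g e = (ftspMechanism p F g).total d := by
  simpa [JumpMechanism.total] using sum_fluidRate_mul (p := p) (F := F) (g := g) d fun _ => 1

/-- In the exponent, the `1 / n` of the time scale turns the total rate into the total rate over
`n`. In the jump probabilities, `n` cancels from the ratio of rates. -/
lemma tendsto_nearFluid_stepProb (hr : p.r21 ≤ p.r12) (hF : 0 < F.m1)
    (hlam1 : Tendsto (fun n : ℕ+ => (N n).lam1 / (n : ℕ)) atTop (𝓝 F.lam1))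
    (hlam2 : Tendsto (fun n : ℕ+ => (N n).lam2 / (n : ℕ)) atTop (𝓝 F.lam2))
    (hm1 : Tendsto (fun n : ℕ+ => ((N n).m1 : ℝ) / (n : ℕ)) atTop (𝓝 F.m1))
    (hm2 : Tendsto (fun n : ℕ+ => ((N n).m2 : ℝ) / (n : ℕ)) atTop (𝓝 F.m2))
    (hpos : 0 < ∑ e, fluidRate p F g e) (d s : ℝ) (C : Set ℝ) :
    Tendsto (fun q : ℕ+ × XState =>
        (xMechanism p (N q.1)).stepProb (s / (q.1 : ℕ)) (diff12 p (N q.1) ⁻¹' C) q.2)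
      (nearFluid p N g ⊓ 𝓟 {q | diff12 p (N q.1) q.2 = d})
      (𝓝 ((ftspMechanism p F g).stepProb s C d)) := by
  have hrate := fun e => (tendsto_nearFluid_rate (p := p) (g := g) hlam1 hlam2 hm1 hm2 e).mono_left
    (inf_le_left (b := 𝓟 {q | diff12 p (N q.1) q.2 = d}))
  have htot : Tendsto (fun q : ℕ+ × XState => (xMechanism p (N q.1)).total q.2 / (q.1 : ℕ))
      (nearFluid p N g ⊓ 𝓟 {q | diff12 p (N q.1) q.2 = d}) (𝓝 (∑ e, fluidRate p F g e)) := by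
    simp only [JumpMechanism.total, Finset.sum_div]
    exact tendsto_finsetSum _ fun e _ => hrate e
  have hlim : Tendsto (fun q : ℕ+ × XState =>
      Real.exp (-((xMechanism p (N q.1)).total q.2 / (q.1 : ℕ) * s)) *
        ∑ e, (xMechanism p (N q.1)).rate e q.2 / (q.1 : ℕ) /
          ((xMechanism p (N q.1)).total q.2 / (q.1 : ℕ)) *
            C.indicator 1 (d + diffJump p.r12 d e))
      (nearFluid p N g ⊓ 𝓟 {q | diff12 p (N q.1) q.2 = d})
      (𝓝 (Real.exp (-((∑ e, fluidRate p F g e) * s)) *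
        ∑ e, fluidRate p F g e / (∑ e, fluidRate p F g e) *
          C.indicator 1 (d + diffJump p.r12 d e))) := by
    refine Tendsto.mul ((Real.continuous_exp.tendsto _).comp (htot.mul_const s).neg) ?_
    exact tendsto_finsetSum _ fun e _ => ((hrate e).div htot hpos.ne').mul_const _
  have hval : Real.exp (-((∑ e, fluidRate p F g e) * s)) *
        ∑ e, fluidRate p F g e / (∑ e, fluidRate p F g e) *
          C.indicator 1 (d + diffJump p.r12 d e) = (ftspMechanism p F g).stepProb s C d := by
    simp only [JumpMechanism.stepProb, div_mul_eq_mul_div, ← Finset.sum_div, sum_fluidRate d]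
    rw [sum_fluidRate_mul d (C.indicator 1)]
  rw [hval] at hlim
  refine hlim.congr' ?_
  rw [EventuallyEq, eventually_inf_principal]
  filter_upwards [eventually_nearFluid_next (g := g) hr hF hm1] with q hq hd
  have hd' : diff12 p (N q.1) q.2 = d := hd
  have hn : ((q.1 : ℕ) : ℝ) ≠ 0 := by exact_mod_cast q.1.ne_zero
  rw [JumpMechanism.stepProb]
  congr 1
  · congr 2
    ring
  · refine Finset.sum_congr rfl fun e _ => ?_
    rw [div_div_div_cancel_right₀ hn, ← hd', ← (hq e).2.2.2.2]
    rfl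

end QueueDifference

/-! ### Verification of the hypotheses and conclusion. -/

lemma xMechanism_rate_nonneg {p : XRates} {N : XSize}
    (hmu11 : 0 < p.mu11) (hmu12 : 0 < p.mu12) (hmu21 : 0 < p.mu21) (hmu22 : 0 < p.mu22)
    (htheta1 : 0 < p.theta1) (htheta2 : 0 < p.theta2) (hlam : 0 < N.lam1 ∧ 0 < N.lam2)
    (e : XEvent) (x : XState) : 0 ≤ (xMechanism p N).rate e x := by
  obtain ⟨h1, h2⟩ := hlam
  cases e <;> simp only [xMechanism] <;> positivity

lemma fluidRate_nonneg {p : XRates} {F : FluidSize} {g : FluidState}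
    (hmu11 : 0 < p.mu11) (hmu12 : 0 < p.mu12) (hmu22 : 0 < p.mu22)
    (htheta1 : 0 < p.theta1) (htheta2 : 0 < p.theta2) (hlam : 0 < F.lam1 ∧ 0 < F.lam2)
    (hm : 0 < F.m1) (hg : g ∈ setA p F) (e : XEvent) : 0 ≤ fluidRate p F g e := by
  obtain ⟨h1, h2⟩ := hlam
  obtain ⟨hq1, hq2, hz, hz', -⟩ := hg
  have := sub_nonneg.2 hz'
  cases e <;> simp only [fluidRate] <;> positivity

lemma ftspMechanism_rate_nonneg {p : XRates} {F : FluidSize} {g : FluidState}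
    (hmu11 : 0 < p.mu11) (hmu12 : 0 < p.mu12) (hmu22 : 0 < p.mu22)
    (htheta1 : 0 < p.theta1) (htheta2 : 0 < p.theta2) (hlam : 0 < F.lam1 ∧ 0 < F.lam2)
    (hm : 0 < F.m1) (hg : g ∈ setA p F) (e : FTSPEvent) (d : ℝ) :
    0 ≤ (ftspMechanism p F g).rate e d := by
  obtain ⟨h1, h2⟩ := hlam
  obtain ⟨hq1, hq2, hz, hz', -⟩ := hg
  have := sub_nonneg.2 hz'
  cases e <;> simp only [ftspMechanism, ratePlus, rateMinus] <;> split_ifs <;> positivity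

lemma ftspMechanism_next_mem_gridPoints {p : XRates} {F : FluidSize} {g : FluidState} {a b : ℕ}
    (hb : 0 < b) (hr12 : p.r12 = (a : ℝ) / b) {d : ℝ} (hd : d ∈ gridPoints b) (e : FTSPEvent) :
    (ftspMechanism p F g).next e d ∈ gridPoints b := by
  have hb' : (b : ℝ) ≠ 0 := by exact_mod_cast hb.ne'
  obtain ⟨i, rfl⟩ := hd
  cases e
  · exact ⟨i + b, by simp only [ftspMechanism]; push_cast; field_simp⟩
  · exact ⟨i + a, by simp only [ftspMechanism, hr12]; push_cast; field_simp⟩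
  · exact ⟨i - b, by simp only [ftspMechanism]; push_cast; field_simp⟩
  · exact ⟨i - a, by simp only [ftspMechanism, hr12]; push_cast; field_simp⟩

lemma diff12_mem_gridPoints {p : XRates} {N : XSize} {a b i : ℕ} (hb : 0 < b)
    (hr12 : p.r12 = (a : ℝ) / b) (hk : N.k12 = (i : ℝ) / b) (x : XState) :
    diff12 p N x ∈ gridPoints b := by
  have hb' : (b : ℝ) ≠ 0 := by exact_mod_cast hb.ne'
  exact ⟨b * x.q1 - i - a * x.q2, by simp only [diff12, hr12, hk]; push_cast; field_simp⟩

/-- The queue difference of a pure-jump path, with time expanded, is a pure-jump path. -/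
lemma isSkeleton_expandedDiff {p : XRates} {N : XSize} {x : Cadlag XState} {t₀ : ℝ≥0} {n : ℕ+}
    {y : ℕ → XState} {t : ℕ → ℝ} (hpos : ∀ k, 0 < t k)
    (hunb : ∀ s : ℝ, ∃ k, s < ∑ i ∈ Finset.range k, t i)
    (heq : ∀ (k : ℕ) (s : ℝ≥0), ∑ i ∈ Finset.range k, t i ≤ s →
      (s : ℝ) < ∑ i ∈ Finset.range (k + 1), t i → x (t₀ + s) = y k) :
    IsSkeleton (expandedDiff p N x t₀ n) (fun k => diff12 p N (y k)) fun k => (n : ℕ) * t k := by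
  have hn : (0 : ℝ) < (n : ℕ) := by exact_mod_cast n.pos
  refine ⟨fun k => mul_pos hn (hpos k), fun s => ?_, fun k s h1 h2 => ?_⟩
  · obtain ⟨k, hk⟩ := hunb (s / (n : ℕ))
    refine ⟨k, ?_⟩
    rwa [← Finset.mul_sum, ← div_lt_iff₀' hn]
  · rw [← Finset.mul_sum] at h1 h2
    refine congrArg (diff12 p N) (heq k (s / ((n : ℕ) : ℝ≥0)) ?_ ?_)
    · push_cast
      rwa [le_div_iff₀' hn]
    · push_cast
      rwa [div_lt_iff₀' hn]

/-- Convergence in law to a constant controls the scaled coordinates, tightness of `D₁₂` with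
divergent thresholds controls the shifted difference, and the constraint that nonempty queues leave
no idle agent gives saturation. -/
lemma probFilter_le_nearFluid {p : XRates} {N : ℕ+ → XSize} {F : FluidSize} {g : FluidState}
    {Ω : ℕ+ → Type*} [∀ n, MeasurableSpace (Ω n)] {P : ∀ n, Measure (Ω n)}
    [∀ n, IsProbabilityMeasure (P n)] {Ω' : Type*} [MeasurableSpace Ω'] {P' : Measure Ω'}
    [IsProbabilityMeasure P'] {Y : ∀ n, Ω n → XState} (hYm : ∀ n, Measurable (Y n)) {D : Ω' → ℝ}
    (hk : Tendsto (fun n => (N n).k12 + (N n).k21) atTop atTop)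
    (hstate : ∀ n, ∀ᵐ ω ∂P n, (N n).IsState (Y n ω))
    (hinit : ∀ K : ℕ, Tendsto
      (fun n : ℕ+ => P n {ω | (Y n ω).z21 = 0 ∧ K < (Y n ω).q1 ∧ K < (Y n ω).q2}) atTop (𝓝 1))
    (hfluid : TendstoInDistribution (fun (n : ℕ+) ω => ((n : ℕ) : ℝ)⁻¹ • (Y n ω).toVec) atTop
      (fun _ : Ω' => g.toVec6 F) P P')
    (hdiff : TendstoInDistribution (fun (n : ℕ+) ω => diff12 p (N n) (Y n ω)) atTop D P P') :
    probFilter atTop P Y ≤ nearFluid p N g := by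
  have hqueue : ∀ K : ℕ, {s : ℕ+ × XState | s.2.z21 = 0 ∧ K < s.2.q1 ∧ K < s.2.q2} ∈
      probFilter atTop P Y := fun K => mem_probFilter_of_tendsto_one hYm (hinit K)
  have hstate' : {s : ℕ+ × XState | (N s.1).IsState s.2} ∈ probFilter atTop P Y := by
    rw [mem_probFilter]
    exact tendsto_const_nhds.congr fun n => (ae_iff.1 (hstate n)).symm
  have hcoord : ∀ i, Tendsto (fun s : ℕ+ × XState => ((s.1 : ℕ) : ℝ)⁻¹ * s.2.toVec i)
      (probFilter atTop P Y) (𝓝 (g.toVec6 F i)) := fun i V hV => by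
    have := hfluid.tendsto_measure_mem_nhds ((continuous_apply i).continuousAt.preimage_mem_nhds hV)
    exact mem_probFilter_of_tendsto_one hYm this
  refine tendsto_id'.1 (tendsto_nearFluid_iff.2 ⟨?_, ?_, ?_, ?_, ?_, ?_, ?_, ?_⟩)
  · intro S hS
    change _ ∈ probFilter atTop P Y
    rw [mem_probFilter]
    refine tendsto_const_nhds.congr' ?_
    filter_upwards [hS] with n hn
    simp [hn]
  · refine tendsto_atTop.2 fun B => ?_
    obtain ⟨K, hK⟩ := exists_nat_ge B
    filter_upwards [hqueue K] with s hs
    exact hK.trans (by exact_mod_cast hs.2.1.le)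
  · refine tendsto_atTop.2 fun B => ?_
    obtain ⟨K, hK⟩ := exists_nat_ge B
    filter_upwards [hqueue K] with s hs
    exact hK.trans (by exact_mod_cast hs.2.2.le)
  · refine tendsto_atTop.2 fun B => ?_
    exact mem_probFilter_of_tendsto_one hYm (hdiff.tendsto_measure_le_add hk B)
  · simpa [div_eq_inv_mul, XState.toVec, FluidState.toVec6] using hcoord 0
  · simpa [div_eq_inv_mul, XState.toVec, FluidState.toVec6] using hcoord 1
  · simpa [div_eq_inv_mul, XState.toVec, FluidState.toVec6] using hcoord 3
  · filter_upwards [hstate', hqueue 0] with s hs hq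
    obtain ⟨-, -, h1, h2, -⟩ := hs
    have h1' := h1 hq.2.1
    rw [hq.1, add_zero] at h1'
    exact ⟨hq.1, h1', h2 hq.2.2⟩

/-- Convergence of the time-expanded queue-difference processes to the fast-time-scale process. -/
theorem theorem4p3
    -- service, abandonment and ratio parameters; `r12 = a / b` and `r21 ≤ r12`
    (p : XRates)
    (hmu11 : 0 < p.mu11) (hmu12 : 0 < p.mu12) (hmu21 : 0 < p.mu21) (hmu22 : 0 < p.mu22)
    (htheta1 : 0 < p.theta1) (htheta2 : 0 < p.theta2)
    (a b : ℕ) (ha : 0 < a) (hb : 0 < b) (hr12 : p.r12 = (a : ℝ) / b)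
    (hr21 : 0 < p.r21) (hr : p.r21 ≤ p.r12)
    -- the sequence of systems, in many-server heavy-traffic scaling
    (N : ℕ+ → XSize) (F : FluidSize)
    (hNlam : ∀ n, 0 < (N n).lam1 ∧ 0 < (N n).lam2)
    (hFlam : 0 < F.lam1 ∧ 0 < F.lam2) (hFm : 0 < F.m1 ∧ 0 < F.m2)
    (hlam1 : Tendsto (fun n : ℕ+ => (N n).lam1 / (n : ℕ)) atTop (𝓝 F.lam1))
    (hlam2 : Tendsto (fun n : ℕ+ => (N n).lam2 / (n : ℕ)) atTop (𝓝 F.lam2))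
    (hm1 : Tendsto (fun n : ℕ+ => ((N n).m1 : ℝ) / (n : ℕ)) atTop (𝓝 F.m1))
    (hm2 : Tendsto (fun n : ℕ+ => ((N n).m2 : ℝ) / (n : ℕ)) atTop (𝓝 F.m2))
    -- scaled thresholds; `k12` is an integer multiple of `1 / b`
    (c : ℕ+ → ℝ) (hc : ∀ n, 0 < c n)
    (hcn : Tendsto (fun n : ℕ+ => c n / (n : ℕ)) atTop (𝓝 0))
    (hcsqrt : Tendsto (fun n : ℕ+ => c n / Real.sqrt (n : ℕ)) atTop atTop)
    (k12 k21 : ℝ) (hk12pos : 0 < k12) (hk21pos : 0 < k21)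
    (hNk : ∀ n, 0 < (N n).k12 ∧ 0 < (N n).k21)
    (hk12 : Tendsto (fun n : ℕ+ => (N n).k12 / c n) atTop (𝓝 k12))
    (hk21 : Tendsto (fun n : ℕ+ => (N n).k21 / c n) atTop (𝓝 k21))
    (hk12rat : ∀ n, ∃ i : ℕ, (N n).k12 = (i : ℝ) / b)
    -- from time `t₀` on, the `n`-th process is the CTMC of the `n`-th system, started in
    -- the random state `X n · t₀`
    {Ω : ℕ+ → Type*} [∀ n, MeasurableSpace (Ω n)]
    (P : ∀ n, Measure (Ω n)) [∀ n, IsProbabilityMeasure (P n)]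
    (t₀ : ℝ≥0) (X : ∀ n, Ω n → Cadlag XState)
    (hX : ∀ n, IsPureJumpMarkov (P n) (xMechanism p (N n)) (fun ω t => X n ω (t₀ + t)))
    -- initial conditions: asymptotically there is no sharing with pool 1 helping class 2, and
    -- the queue lengths are unbounded in probability
    (hstate : ∀ n, ∀ᵐ ω ∂P n, (N n).IsState (X n ω t₀))
    (hinit : ∀ K : ℕ, Tendsto
      (fun n : ℕ+ => P n {ω | (X n ω t₀).z21 = 0 ∧ K < (X n ω t₀).q1 ∧ K < (X n ω t₀).q2})
      atTop (𝓝 1))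
    -- the FTSP for a fluid state `g ∈ 𝔸`
    (g : FluidState) (hg : g ∈ setA p F)
    {Ω' : Type*} [MeasurableSpace Ω'] (P' : Measure Ω') [IsProbabilityMeasure P']
    (D : Ω' → Cadlag ℝ)
    (hD : IsPureJumpMarkov P' (ftspMechanism p F g) (fun ω s => D ω s))
    -- convergence of the scaled states and of the differences at time `t₀`
    (hfluid : TendstoInDistribution (fun (n : ℕ+) ω => ((n : ℕ) : ℝ)⁻¹ • (X n ω t₀).toVec) atTop
      (fun _ : Ω' => g.toVec6 F) P P')
    (hdiff : TendstoInDistribution (fun (n : ℕ+) ω => expandedDiff p (N n) (X n ω) t₀ n 0) atTop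
      (fun ω => D ω 0) P P') :
    TendstoInDistribution (fun (n : ℕ+) ω => expandedDiff p (N n) (X n ω) t₀ n) atTop D P P' := by

  have hb' : (0 : ℝ) < b := by exact_mod_cast hb
  choose Y T hYm hTm hT hunb heq hlaw using hX
  obtain ⟨Y', T', hYm', hTm', hT', hunb', heq', hlaw'⟩ := hD
  have hgrid : ∀ n x, diff12 p (N n) x ∈ gridPoints b := fun n x => by
    obtain ⟨i, hi⟩ := hk12rat n
    exact diff12_mem_gridPoints hb hr12 hi x
  have hX0 : ∀ n, ∀ᵐ ω ∂P n, X n ω t₀ = Y n 0 ω := fun n => by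
    filter_upwards [hT n, heq n] with ω h1 h2
    simpa using h2 0 0 (by simp) (by simpa using h1 0)
  have hD0 : ∀ᵐ ω ∂P', D ω 0 = Y' 0 ω := by
    filter_upwards [hT', heq'] with ω h1 h2
    exact h2 0 0 (by simp) (by simpa using h1 0)
  have hdiff' : TendstoInDistribution (fun (n : ℕ+) ω => diff12 p (N n) (Y n 0 ω)) atTop (Y' 0)
      P P' := by
    refine hdiff.congr (fun n => ?_) hD0
    filter_upwards [hX0 n] with ω hω
    simp [expandedDiff, Cadlag.expand, hω]
  have hfluid' : TendstoInDistribution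
      (fun (n : ℕ+) ω => ((n : ℕ) : ℝ)⁻¹ • (Y n 0 ω).toVec) atTop
      (fun _ : Ω' => g.toVec6 F) P P' := by
    refine hfluid.congr (fun n => ?_) (ae_eq_refl _)
    filter_upwards [hX0 n] with ω hω
    rw [hω]
  -- The initial value is on the grid as a limit in law of variables in a closed set, and all jumps
  -- preserve the grid.
  have hY'grid : ∀ᵐ ω ∂P', ∀ k, Y' k ω ∈ gridPoints b :=
    HasJumpLaw.ae_forall_mem hlaw' hYm' hT' (isClosed_gridPoints hb').measurableSet
      (fun d hd e => ftspMechanism_next_mem_gridPoints hb hr12 hd e)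
      (hdiff'.ae_mem_of_isClosed (isClosed_gridPoints hb') fun n ω => hgrid n _)
  have hk : Tendsto (fun n => (N n).k12 + (N n).k21) atTop atTop := by
    -- `c n` dominates `c n / √n` because `√n ≥ 1`.
    have hcinf : Tendsto c atTop atTop := by
      refine tendsto_atTop_mono' _ ?_ hcsqrt
      refine Eventually.of_forall fun n => div_le_self (hc n).le ?_
      exact Real.one_le_sqrt.2 (by exact_mod_cast n.pos)
    refine tendsto_atTop_mono (fun n => le_add_of_nonneg_right (hNk n).2.le)
      ((hk12.pos_mul_atTop hk12pos hcinf).congr fun n => ?_)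
    exact div_mul_cancel₀ _ (hc n).ne'
  have hprob : ∀ k, probFilter atTop P (fun n => Y n k) ≤ nearFluid p N g := fun k => by
    induction k with
    | zero =>
      refine probFilter_le_nearFluid (fun n => hYm n 0) hk (fun n => ?_) (fun K => ?_) hfluid' hdiff'
      · filter_upwards [hstate n, hX0 n] with ω h1 h2
        rwa [← h2]
      · refine (hinit K).congr fun n => measure_congr ?_
        filter_upwards [hX0 n] with ω hω
        refine propext ?_
        change (_ ∧ _ ∧ _) ↔ (_ ∧ _ ∧ _)
        rw [hω]
    | succ k ih =>
      exact probFilter_succ_le (G := fun n => xMechanism p (N n)) hlaw hYm hT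
        (fun S hS => eventually_nearFluid_next_mem hr hFm.1 hm1 hS) ih
  have hG := fun n => xMechanism_rate_nonneg (N := N n) hmu11 hmu12 hmu21 hmu22 htheta1 htheta2
    (hNlam n)
  have hH := ftspMechanism_rate_nonneg hmu11 hmu12 hmu22 htheta1 htheta2 hFlam hFm.1 hg
  have hpos : 0 < ∑ e, fluidRate p F g e :=
    Finset.sum_pos' (fun e _ => fluidRate_nonneg hmu11 hmu12 hmu22 htheta1 htheta2 hFlam hFm.1 hg e)
      ⟨.arr1, Finset.mem_univ _, hFlam.1⟩
  have hinitial : ∀ j : ℤ, Tendsto (fun n => P n {ω | ⌊(b : ℝ) * diff12 p (N n) (Y n 0 ω)⌋ = j})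
      atTop (𝓝 (P' {ω | ⌊(b : ℝ) * Y' 0 ω⌋ = j})) := fun j => by
    have hnull : P' {ω | Y' 0 ω ∈ frontier (Metric.ball ((j : ℝ) / b) (1 / (2 * b)))} = 0 := by
      rw [measure_eq_zero_iff_ae_notMem]
      filter_upwards [hY'grid] with ω hω hmem
      exact notMem_sphere_of_mem_gridPoints hb' (hω 0) j (Metric.frontier_ball_subset_sphere hmem)
    have hlim := hdiff'.tendsto_measure_of_null_frontier measurableSet_ball hnull
    have e' : P' {ω | Y' 0 ω ∈ Metric.ball ((j : ℝ) / b) (1 / (2 * b))} =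
        P' {ω | ⌊(b : ℝ) * Y' 0 ω⌋ = j} := by
      refine measure_congr ?_
      filter_upwards [hY'grid] with ω hω
      exact propext ((mem_ball_iff_of_mem_gridPoints hb' (hω 0) j).trans
        (floor_eq_iff_of_mem_gridPoints hb' (hω 0) j).symm)
    rw [← e']
    refine hlim.congr fun n => congrArg (P n) (Set.ext fun ω => ?_)
    exact (mem_ball_iff_of_mem_gridPoints hb' (hgrid n _) j).trans
      (floor_eq_iff_of_mem_gridPoints hb' (hgrid n _) j).symm
  have hn : ∀ n : ℕ+, (0 : ℝ) < (n : ℕ) := fun n => by exact_mod_cast n.pos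
  -- Grid points `d` are encoded by the integers `⌊b * d⌋` and decoded by division by `b`. Holding
  -- times are multiplied by `n` because time is expanded.
  refine tendstoInDistribution_of_tendsto_cellIndex P P' (fun i => (i : ℝ) / b)
    (i := fun n k ω => ⌊(b : ℝ) * diff12 p (N n) (Y n k ω)⌋)
    (t := fun n k ω => (n : ℕ) * T n k ω) (i' := fun k ω => ⌊(b : ℝ) * Y' k ω⌋) (t' := T')
    (fun n k => (Measurable.of_discrete (f := fun x => ⌊(b : ℝ) * diff12 p (N n) x⌋)).comp (hYm n k))
    (fun n k => (hTm n k).const_mul _) (fun n => ?_)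
    (fun k => Int.measurable_floor.comp ((hYm' k).const_mul _)) hTm' ?_ (fun m j => ?_)
  · filter_upwards [hT n, hunb n, heq n] with ω h1 h2 h3
    simp only [floor_div_of_mem_gridPoints hb' (hgrid n _)]
    exact isSkeleton_expandedDiff h1 h2 h3
  · filter_upwards [hT', hunb', heq', hY'grid] with ω h1 h2 h3 h4
    simp only [floor_div_of_mem_gridPoints hb' (h4 _)]
    exact ⟨h1, h2, h3⟩
  · rw [setOf_cellIndex_eq]
    simp only [setOf_cellIndex_eq]
    exact tendsto_measure_cellEvent (G := fun n => xMechanism p (N n)) hG hlaw hYm hTm hT hH hlaw'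
      hYm' hTm' hT' hb' hgrid hY'grid hn hprob
      (fun d s _ C => tendsto_nearFluid_stepProb hr hFm.1 hlam1 hlam2 hm1 hm2 hpos d s C)
      hinitial (by positivity) _ _ m
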